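/- Call $p:\mathbb{N}\to[0,1]$ natural if either $p(n)=0$ for all $n$, or $p(n)=n^{-g(n)}$ for all $n\ge 2$, where $g\ge 0$ is a function whose limit $c_g=\lim_{n\to\infty}g(n)$ exists in $\mathbb{R}$; call a natural $p$ dense if it is of the second kind with $c_g=0$, and sparse otherwise. Let $\mathcal{G}(n,p)$ be the random graph on $n$ vertices in which each pair of vertices is adjacent independently with probability $p(n)$. For a deterministic algorithm $M$ that takes a graph $G$ and a number $k\in\mathbb{N}$ as input, let $t_M(G,k)$ be its number of steps on a random access machine with addition and subtraction at unit cost. There are two deterministic algorithms $\mathcal{A}$ and $\mathcal{B}$ that do not depend on $p$, each of which decides correctly, for every graph $G$ and every $k$, whether $G$ has a clique with exactly $k$ vertices, such that for every natural $p$ the following two statements hold for $M=\mathcal{A}$ if $p$ is dense, and for $M=\mathcal{B}$ if $p$ is sparse. (1) $M$ runs in typFPT time on $\mathcal{G}(n,p)$: there are a function $f:\mathbb{N}\to\mathbb{N}$ and a polynomial $r$ such that for every $k$ and every eventually positive polynomial $q$ there is an $n_0$ with $$\Pr\big[t_M(\mathcal{G}(n,p),k)>f(k)\cdot r(n)\big]<\frac{1}{q(n)}\qquad\text{for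 all } n>n_0 .$$ (2) The same $M$ runs in avgFPT time on $\mathcal{G}(n,p)$: there are a constant $c$ and a function $f:\mathbb{N}\to\mathbb{N}$ such that for every $k$ $$\sum_{n\ge 1}\mathbb{E}\left[\frac{t_M(\mathcal{G}(n,p),k)}{n^{c}}\right]<f(k).$$ -/

import Mathlib

open Filter Topology MeasureTheory unitInterval
open scoped ENNReal

/-! ### Random access machines

Registers `r_0, r_1, …` hold natural numbers.  The arithmetic is addition and truncated
subtraction only, and every executed instruction costs one unit of time. -/

namespace RAM

/-- Instructions of a random access machine. -/
inductive Instr where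
  /-- `r_d := c` -/
  | const (d c : ℕ)
  /-- `r_d := r_a` -/
  | copy (d a : ℕ)
  /-- `r_d := r_a + r_b` -/
  | add (d a b : ℕ)
  /-- `r_d := max (r_a - r_b) 0` -/
  | sub (d a b : ℕ)
  /-- `r_d := r_(r_a)` -/
  | load (d a : ℕ)
  /-- `r_(r_d) := r_a` -/
  | store (d a : ℕ)
  /-- go to instruction number `l` -/
  | jump (l : ℕ)
  /-- go to instruction number `l` if `r_a = 0`, and to the next instruction otherwise -/
  | jumpZero (a l : ℕ)

/-- A program is a finite list of instructions, numbered from `0`. -/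
abbrev Program : Type := List Instr

/-- A configuration: the program counter and the contents of all registers. -/
@[ext]
structure Config where
  pc : ℕ
  mem : ℕ → ℕ

/-- The effect of a single instruction. -/
def Instr.exec : Instr → Config → Config
  | .const d c, s => ⟨s.pc + 1, Function.update s.mem d c⟩
  | .copy d a, s => ⟨s.pc + 1, Function.update s.mem d (s.mem a)⟩
  | .add d a b, s => ⟨s.pc + 1, Function.update s.mem d (s.mem a + s.mem b)⟩
  | .sub d a b, s => ⟨s.pc + 1, Function.update s.mem d (s.mem a - s.mem b)⟩
  | .load d a, s => ⟨s.pc + 1, Function.update s.mem d (s.mem (s.mem a))⟩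
  | .store d a, s => ⟨s.pc + 1, Function.update s.mem (s.mem d) (s.mem a)⟩
  | .jump l, s => ⟨l, s.mem⟩
  | .jumpZero a l, s => ⟨if s.mem a = 0 then l else s.pc + 1, s.mem⟩

/-- The machine has halted when the program counter points outside the program. -/
def Halted (P : Program) (s : Config) : Prop := P.length ≤ s.pc

/-- One step of the machine; a halted configuration does not change any more. -/
def step (P : Program) (s : Config) : Config :=
  match P[s.pc]? with
  | some i => i.exec s
  | none => s

/-- The configuration after `t` steps. -/
def run (P : Program) (t : ℕ) (s : Config) : Config := (step P)^[t] s

/-- The number of steps after which the machine halts (meaningful if it halts at all). -/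
noncomputable def runTime (P : Program) (s : Config) : ℕ :=
  sInf {t : ℕ | Halted P (run P t s)}

end RAM

/-! ### The parameterized clique problem -/

namespace Clique

open Classical in
/-- The initial register contents on input `(G, k)`: `r_0 = k`, `r_1 = n`, then the adjacency
matrix of `G` row by row; all other registers are `0`. -/
noncomputable def inputMem {n : ℕ} (G : SimpleGraph (Fin n)) (k : ℕ) : ℕ → ℕ := fun a =>
  if a = 0 then k
  else if a = 1 then n
  else if ∃ i j : Fin n, a = 2 + (i : ℕ) * n + (j : ℕ) ∧ G.Adj i j then 1
  else 0

/-- The initial configuration on input `(G, k)`. -/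
noncomputable def initial {n : ℕ} (G : SimpleGraph (Fin n)) (k : ℕ) : RAM.Config :=
  ⟨0, inputMem G k⟩

/-- `P` decides the clique problem: on *every* input `(G, k)` it halts, and it accepts
(with `r_0 ≠ 0`) if and only if `G` has a clique on exactly `k` vertices. -/
def Decides (P : RAM.Program) : Prop :=
  ∀ (n : ℕ) (G : SimpleGraph (Fin n)) (k : ℕ), ∃ t : ℕ,
    RAM.Halted P (RAM.run P t (initial G k)) ∧
      ((RAM.run P t (initial G k)).mem 0 ≠ 0 ↔ ∃ S : Finset (Fin n), G.IsNClique k S)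

/-- The running time of `P` on input `(G, k)`. -/
noncomputable def time (P : RAM.Program) {n : ℕ} (G : SimpleGraph (Fin n)) (k : ℕ) : ℕ :=
  RAM.runTime P (initial G k)

/-- `P` runs in typFPT time on the random graphs `G(n, p(n))`: it needs more than
`f(k) · r(n)` steps only with a probability that is eventually (from a point on that may depend
on `k`) below the inverse of any given polynomial. -/
def RunsInTypFPT (P : RAM.Program) (p : ℕ → I) : Prop :=
  ∃ (f : ℕ → ℕ) (r : Polynomial ℕ), ∀ (k : ℕ) (q : Polynomial ℝ),
    (∀ᶠ n : ℕ in atTop, 0 < q.eval (n : ℝ)) →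
      ∃ n₀ : ℕ, ∀ n : ℕ, n₀ < n →
        (SimpleGraph.binomialRandom (Fin n) (p n)).real
          {G | f k * r.eval n < time P G k} < 1 / q.eval (n : ℝ)

/-- `P` runs in avgFPT time on the random graphs `G(n, p(n))`: the expected running times,
divided by `n ^ c` and summed over all `n ≥ 1`, stay below `f(k)`. -/
def RunsInAvgFPT (P : RAM.Program) (p : ℕ → I) : Prop :=
  ∃ (c : ℕ) (f : ℕ → ℕ), ∀ k : ℕ,
    ∑' n : ℕ+, ∫⁻ G, (time P G k : ℝ≥0∞) / ((n : ℕ) : ℝ≥0∞) ^ c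
      ∂(SimpleGraph.binomialRandom (Fin n) (p n)) < (f k : ℝ≥0∞)

end Clique

/-! ### Natural edge probabilities -/

/-- `p(n) = n ^ (-g(n))` for a non-negative function `g` with limit `c`.  The values at
`n = 0, 1` are not constrained: graphs with fewer than two vertices have no edges. -/
def HasLimitExponent (p : ℕ → I) (c : ℝ) : Prop :=
  ∃ g : ℕ → ℝ, (∀ n, 0 ≤ g n) ∧ (∀ n : ℕ, 2 ≤ n → (p n : ℝ) = (n : ℝ) ^ (-g n)) ∧
    Tendsto g atTop (𝓝 c)

/-- Natural edge probabilities: identically `0`, or `n ^ (-g(n))` with convergent `g ≥ 0`. -/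
def IsNatural (p : ℕ → I) : Prop :=
  (∀ n, p n = 0) ∨ ∃ c : ℝ, HasLimitExponent p c

/-!
One program serves both for dense and for sparse edge probabilities.  It is a backtracking search
that visits the cliques of the graph in colexicographic order (`CliqueSearch.Invariant`): the
current clique `K` is read as the binary number `code K`, and the search is a binary counter that
skips all numbers whose leading digits already contain two non-adjacent vertices.  This order has
the following consequence: if `{0, …, m - 1}` contains a `k`-clique, then only cliques inside this
set are visited before the search succeeds.  Hence the running time is at most
`400 * (n + 1) ^ 2` times the number of cliques on at most `k` vertices inside `{0, …, m - 1}`, where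
`m = n`, or `m` is any number such that a `k`-clique exists inside this set
(`CliqueSearch.time_program_le`).

* If `p(n) ≤ n ^ (-δ)` eventually, choose `L` so large that the expected number of `L`-cliques is at
  most `n ^ (-L)`.  Then `s` pairwise disjoint `L`-cliques exist with probability at most
  `n ^ (-s)` only.  If they do not exist, then a set of `s * L` vertices meets all `L`-cliques, so there
  are at most `2 ^ (s * L) * (n + 1) ^ L` cliques at all, and `L` depends on `δ` only
  (`CliqueSearch.hasSmallTail_of_le_rpow`).
* If `p(n) = n ^ (-o(1))`, then one of the first `n ^ (1 / (2 * k))` blocks of `k` consecutive vertices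
  is a clique, except with a probability below the inverse of every polynomial.  There are only
  `O(n)` sets of at most `k` vertices inside the union of these blocks
  (`CliqueSearch.hasSmallTail_of_rpow_le`).

In both cases the running time exceeds `f(k) * (n + 1) ^ d` with a probability below the inverse of
every polynomial.  This gives typical efficiency at once, and average efficiency since
the running time is never more than `400 * (n + 1) ^ (k + 2)`.
-/

set_option linter.unusedSimpArgs false

/-! ### Structured programs for the random access machine -/

namespace RAM

/-- The instruction always continues with the next one. -/
def Instr.IsStraight : Instr → Prop
  | .jump _ => False
  | .jumpZero _ _ => False
  | _ => True

instance : DecidablePred Instr.IsStraight := fun i => by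
  cases i <;> unfold Instr.IsStraight <;> infer_instance

/-- The effect of an instruction on the registers; jumps leave them unchanged. -/
def Instr.act (m : ℕ → ℕ) : Instr → (ℕ → ℕ)
  | .const d c => Function.update m d c
  | .copy d a => Function.update m d (m a)
  | .add d a b => Function.update m d (m a + m b)
  | .sub d a b => Function.update m d (m a - m b)
  | .load d a => Function.update m d (m (m a))
  | .store d a => Function.update m (m d) (m a)
  | .jump _ => m
  | .jumpZero _ _ => m

/-- Structured programs: straight-line blocks, composition, a test for zero, and a loop that is
repeated as long as a register is nonzero. -/
inductive Cmd where
  | block (l : List Instr)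
  | seq (c d : Cmd)
  | ifz (a : ℕ) (c d : Cmd)
  | loop (a : ℕ) (c : Cmd)

namespace Cmd

/-- The number of machine instructions that a structured program is translated to. -/
def len : Cmd → ℕ
  | block l => l.length
  | seq c d => c.len + d.len
  | ifz _ c d => c.len + d.len + 2
  | loop _ c => c.len + 2

/-- Translation to machine code that is to be placed at address `o`. -/
def compile : Cmd → ℕ → Program
  | block l, _ => l
  | seq c d, o => c.compile o ++ d.compile (o + c.len)
  | ifz a c d, o =>
      Instr.jumpZero a (o + d.len + 2) :: (d.compile (o + 1) ++
        Instr.jump (o + d.len + 2 + c.len) :: c.compile (o + d.len + 2))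
  | loop a c, o =>
      Instr.jumpZero a (o + c.len + 2) :: (c.compile (o + 1) ++ [Instr.jump o])

theorem length_compile (c : Cmd) (o : ℕ) : (c.compile o).length = c.len := by
  induction c generalizing o with
  | block l => rfl
  | seq c d hc hd => simp [compile, len, hc, hd]
  | ifz a c d hc hd => simp [compile, len, hc, hd]; omega
  | loop a c hc => simp [compile, len, hc]

end Cmd

theorem run_add (P : Program) (s t : ℕ) (x : Config) :
    run P (s + t) x = run P t (run P s x) := by
  simp only [run, Nat.add_comm s t, Function.iterate_add_apply]

theorem run_one_of_getElem? {P : Program} {x : Config} {i : Instr} (h : P[x.pc]? = some i) :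
    run P 1 x = i.exec x := by
  simp [run, step, h]

/-- Wherever the code of `c` is placed in a program, it leads in `t` steps from its first
instruction and memory `m` to the position behind its last instruction and memory `m'`. -/
def Leads (c : Cmd) (m : ℕ → ℕ) (t : ℕ) (m' : ℕ → ℕ) : Prop :=
  ∀ pre post : Program, run (pre ++ (c.compile pre.length ++ post)) t ⟨pre.length, m⟩ =
    ⟨pre.length + c.len, m'⟩

theorem Leads.block {l : List Instr} (hl : ∀ i ∈ l, i.IsStraight) (m : ℕ → ℕ) :
    Leads (.block l) m l.length (l.foldl Instr.act m) := by
  intro pre post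
  simp only [Cmd.compile, Cmd.len]
  induction l generalizing pre m with
  | nil => simp [run]
  | cons i l ih =>
    have hi : i.exec ⟨pre.length, m⟩ = ⟨pre.length + 1, i.act m⟩ := by
      have := hl i (by simp)
      cases i <;> simp_all [Instr.exec, Instr.act, Instr.IsStraight]
    have h := ih (fun j hj => hl j (by simp [hj])) (i.act m) (pre ++ [i])
    rw [List.length_cons, Nat.add_comm, run_add,
      run_one_of_getElem? (i := i) (by simp), hi]
    simp only [List.append_assoc, List.singleton_append, List.length_append,
      List.length_singleton] at h
    simp only [List.cons_append, List.foldl_cons]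
    rw [h]
    congr 1
    omega

theorem Leads.seq {c d : Cmd} {m m' m'' : ℕ → ℕ} {s t : ℕ} (hc : Leads c m s m')
    (hd : Leads d m' t m'') : Leads (.seq c d) m (s + t) m'' := by
  intro pre post
  have h₁ := hc pre (d.compile (pre.length + c.len) ++ post)
  have h₂ := hd (pre ++ c.compile pre.length) post
  simp only [List.length_append, Cmd.length_compile, List.append_assoc] at h₂
  simp only [Cmd.compile, Cmd.len, List.append_assoc]
  rw [run_add, h₁, h₂, Nat.add_assoc]

theorem Leads.ifz_zero {a : ℕ} {c d : Cmd} {m m' : ℕ → ℕ} {t : ℕ} (ha : m a = 0)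
    (hc : Leads c m t m') : Leads (.ifz a c d) m (1 + t) m' := by
  intro pre post
  have h := hc (pre ++ Instr.jumpZero a (pre.length + d.len + 2) :: (d.compile (pre.length + 1) ++
        [Instr.jump (pre.length + d.len + 2 + c.len)])) post
  simp only [List.length_append, Cmd.length_compile, List.append_assoc, List.length_cons,
    List.length_nil, List.cons_append, List.nil_append] at h
  rw [show pre.length + (d.len + (0 + 1) + 1) = pre.length + d.len + 2 by omega] at h
  simp only [Cmd.compile, Cmd.len, List.append_assoc, List.cons_append]
  rw [run_add, run_one_of_getElem? (i := .jumpZero a (pre.length + d.len + 2)) (by simp)]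
  simp only [Instr.exec, ha, if_true]
  rw [h]
  congr 1
  omega

theorem Leads.ifz_ne_zero {a : ℕ} {c d : Cmd} {m m' : ℕ → ℕ} {t : ℕ} (ha : m a ≠ 0)
    (hd : Leads d m t m') : Leads (.ifz a c d) m (1 + t + 1) m' := by
  intro pre post
  have h := hd (pre ++ [Instr.jumpZero a (pre.length + d.len + 2)])
    (Instr.jump (pre.length + d.len + 2 + c.len) :: (c.compile (pre.length + d.len + 2) ++ post))
  simp only [List.length_append, List.append_assoc, List.length_cons,
    List.length_nil, List.cons_append, List.nil_append, Nat.zero_add] at h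
  simp only [Cmd.compile, Cmd.len, List.append_assoc, List.cons_append]
  rw [run_add, run_add, run_one_of_getElem? (x := ⟨pre.length, m⟩)
    (i := .jumpZero a (pre.length + d.len + 2)) (by simp)]
  simp only [Instr.exec, ha, if_false]
  rw [h, run_one_of_getElem? (i := .jump (pre.length + d.len + 2 + c.len))]
  · simp only [Instr.exec]
    congr 1
    omega
  · rw [List.getElem?_append_right (by simp; omega),
      show pre.length + 1 + d.len - pre.length = d.len + 1 by omega, List.getElem?_cons_succ,
      List.getElem?_append_right (by simp [Cmd.length_compile])]
    simp [Cmd.length_compile]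

theorem Leads.loop_zero {a : ℕ} {c : Cmd} {m : ℕ → ℕ} (ha : m a = 0) :
    Leads (.loop a c) m 1 m := by
  intro pre post
  simp only [Cmd.compile, Cmd.len, List.append_assoc, List.cons_append]
  rw [run_one_of_getElem? (i := .jumpZero a (pre.length + c.len + 2)) (by simp)]
  simp only [Instr.exec, ha, if_true]
  rfl

theorem Leads.loop_step {a : ℕ} {c : Cmd} {m m' m'' : ℕ → ℕ} {s t : ℕ} (ha : m a ≠ 0)
    (hc : Leads c m s m') (hl : Leads (.loop a c) m' t m'') :
    Leads (.loop a c) m (1 + s + 1 + t) m'' := by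
  intro pre post
  have h₁ := hc (pre ++ [Instr.jumpZero a (pre.length + c.len + 2)])
    (Instr.jump pre.length :: post)
  have h₂ := hl pre post
  simp only [List.length_append, List.append_assoc, List.length_cons,
    List.length_nil, List.cons_append, List.nil_append, Nat.zero_add] at h₁
  simp only [Cmd.compile, List.append_assoc, List.cons_append,
    List.nil_append] at h₂ ⊢
  rw [run_add, run_add, run_add, run_one_of_getElem? (x := ⟨pre.length, m⟩)
    (i := .jumpZero a (pre.length + c.len + 2)) (by simp)]
  simp only [Instr.exec, ha, if_false]
  rw [h₁, run_one_of_getElem? (i := .jump pre.length), ← h₂]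
  · rfl
  · rw [List.getElem?_append_right (by simp; omega),
      show pre.length + 1 + c.len - pre.length = c.len + 1 by omega, List.getElem?_cons_succ,
      List.getElem?_append_right (by simp [Cmd.length_compile])]
    simp [Cmd.length_compile]

/-- Total correctness with a time bound: started in memory `m`, the program `c` finishes after at
most `T` steps in a memory that satisfies `Q`. -/
def Runs (c : Cmd) (m : ℕ → ℕ) (T : ℕ) (Q : (ℕ → ℕ) → Prop) : Prop :=
  ∃ t m', t ≤ T ∧ Leads c m t m' ∧ Q m'

theorem Runs.block {l : List Instr} {m : ℕ → ℕ} {T : ℕ} {Q : (ℕ → ℕ) → Prop}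
    (hl : ∀ i ∈ l, i.IsStraight) (hT : l.length ≤ T) (hQ : Q (l.foldl Instr.act m)) :
    Runs (.block l) m T Q :=
  ⟨_, _, hT, Leads.block hl m, hQ⟩

theorem Runs.seq {c d : Cmd} {m : ℕ → ℕ} {S T : ℕ} {Q : (ℕ → ℕ) → Prop}
    (h : Runs c m S fun m' => Runs d m' T Q) : Runs (.seq c d) m (S + T) Q := by
  obtain ⟨s, m', hs, hc, t, m'', ht, hd, hQ⟩ := h
  exact ⟨s + t, m'', by omega, hc.seq hd, hQ⟩

theorem Runs.ifz {a : ℕ} {c d : Cmd} {m : ℕ → ℕ} {T : ℕ} {Q : (ℕ → ℕ) → Prop}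
    (h₀ : m a = 0 → Runs c m T Q) (h₁ : m a ≠ 0 → Runs d m T Q) :
    Runs (.ifz a c d) m (T + 2) Q := by
  by_cases ha : m a = 0
  · obtain ⟨t, m', ht, hc, hQ⟩ := h₀ ha
    exact ⟨1 + t, m', by omega, .ifz_zero ha hc, hQ⟩
  · obtain ⟨t, m', ht, hd, hQ⟩ := h₁ ha
    exact ⟨1 + t + 1, m', by omega, .ifz_ne_zero ha hd, hQ⟩

theorem Runs.mono {c : Cmd} {m : ℕ → ℕ} {S T : ℕ} {Q R : (ℕ → ℕ) → Prop}
    (h : Runs c m S Q) (hST : S ≤ T) (hQR : ∀ m', Q m' → R m') : Runs c m T R := by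
  obtain ⟨t, m', ht, hc, hQ⟩ := h
  exact ⟨t, m', ht.trans hST, hc, hQR _ hQ⟩

/-- Loop rule: the invariant `J j` bounds the number of remaining rounds by `j`. -/
theorem Runs.loop {a : ℕ} {c : Cmd} {T : ℕ} {Q : (ℕ → ℕ) → Prop} (J : ℕ → (ℕ → ℕ) → Prop)
    (h₀ : ∀ j m, J j m → m a = 0 → Q m)
    (h₁ : ∀ j m, J j m → m a ≠ 0 → ∃ i < j, Runs c m T (J i)) :
    ∀ j m, J j m → Runs (.loop a c) m (j * (T + 2) + 1) Q := by
  intro j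
  induction j using Nat.strong_induction_on with
  | _ j ih =>
    intro m hm
    by_cases ha : m a = 0
    · exact ⟨1, m, by omega, .loop_zero ha, h₀ j m hm ha⟩
    · obtain ⟨i, hij, s, m', hs, hc, hi⟩ := h₁ j m hm ha
      obtain ⟨t, m'', ht, hl, hQ⟩ := ih i hij m' hi
      refine ⟨_, m'', ?_, .loop_step ha hc hl, hQ⟩
      have : (i + 1) * (T + 2) ≤ j * (T + 2) := Nat.mul_le_mul_right _ hij
      rw [Nat.add_mul] at this
      omega

theorem Runs.exists_halted {c : Cmd} {m : ℕ → ℕ} {T : ℕ} {Q : (ℕ → ℕ) → Prop}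
    (h : Runs c m T Q) :
    ∃ t ≤ T, Halted (c.compile 0) (run (c.compile 0) t ⟨0, m⟩) ∧
      Q (run (c.compile 0) t ⟨0, m⟩).mem := by
  obtain ⟨t, m', ht, hc, hQ⟩ := h
  have := hc [] []
  simp only [List.length_nil, List.nil_append, List.append_nil, Nat.zero_add] at this
  refine ⟨t, ht, ?_⟩
  rw [this]
  exact ⟨by simp [Halted, Cmd.length_compile], hQ⟩

end RAM

/-! ### Enumeration of cliques in colexicographic order -/

namespace CliqueSearch

/-- The number whose binary digits form the indicator function of `K`. -/
def code (K : Finset ℕ) : ℕ := ∑ v ∈ K, 2 ^ v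

theorem code_insert {K : Finset ℕ} {u : ℕ} (hu : u ∉ K) :
    code (insert u K) = code K + 2 ^ u := by
  rw [code, Finset.sum_insert hu, Nat.add_comm, code]

theorem code_erase_add {K : Finset ℕ} {u : ℕ} (hu : u ∈ K) :
    code (K.erase u) + 2 ^ u = code K :=
  Finset.sum_erase_add _ _ hu

theorem code_lt_of_subset {K : Finset ℕ} {m : ℕ} (h : K ⊆ Finset.range m) : code K < 2 ^ m :=
  Nat.geomSum_lt le_rfl fun _ hv => Finset.mem_range.1 (h hv)

theorem lt_of_code_lt {K : Finset ℕ} {m v : ℕ} (h : code K < 2 ^ m) (hv : v ∈ K) : v < m := by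
  have : 2 ^ v ≤ code K := Finset.single_le_sum (f := fun v => 2 ^ v) (fun _ _ => Nat.zero_le _) hv
  exact (Nat.pow_lt_pow_iff_right (by norm_num)).1 (this.trans_lt h)

theorem dvd_code {K : Finset ℕ} {u : ℕ} (h : ∀ v ∈ K, u ≤ v) : 2 ^ u ∣ code K :=
  Finset.dvd_sum fun v hv => pow_dvd_pow 2 (h v hv)

/-- The binary digits of `code Q` from position `u` on are those of `code K + 2 ^ u`. -/
theorem insert_subset_of_code {K Q : Finset ℕ} {u : ℕ} (hK : ∀ v ∈ K, u ≤ v) (hu : u ∉ K)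
    (h₁ : code K + 2 ^ u ≤ code Q) (h₂ : code Q < code K + 2 ^ (u + 1)) : insert u K ⊆ Q := by
  have hQ : code Q = code (Q.filter (u ≤ ·)) + code (Q.filter (¬ u ≤ ·)) :=
    (Finset.sum_filter_add_sum_filter_not Q (u ≤ ·) _).symm
  have hlow : code (Q.filter (¬ u ≤ ·)) < 2 ^ u :=
    code_lt_of_subset fun v hv => by simpa using (Finset.mem_filter.1 hv).2
  obtain ⟨a, ha⟩ : 2 ^ u ∣ code (insert u K) :=
    dvd_code fun v hv => (Finset.mem_insert.1 hv).elim (fun h => h.ge) (hK v)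
  obtain ⟨b, hb⟩ : 2 ^ u ∣ code (Q.filter (u ≤ ·)) :=
    dvd_code fun v hv => (Finset.mem_filter.1 hv).2
  rw [code_insert hu] at ha
  have hab : a = b := by
    rw [pow_succ] at h₂
    apply le_antisymm <;> refine Nat.lt_succ_iff.1 (Nat.lt_of_mul_lt_mul_left (a := 2 ^ u) ?_) <;>
      rw [Nat.mul_succ] <;> omega
  have heq : insert u K = Q.filter (u ≤ ·) := by
    apply Finset.geomSum_injective (n := 2) le_rfl
    change code _ = code _
    rw [code_insert hu, ha, hb, hab]
  rw [heq]
  exact Finset.filter_subset _ _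

/-- The invariant of the search in the graph `H` on `{0, …, n - 1}`: `K` is the current clique, and
`u` the vertex that is considered next.  No `k`-clique has a code below `code K + 2 ^ u`, so
all cliques of the subtrees that have been left can be forgotten. -/
structure Invariant (H : SimpleGraph ℕ) (n k : ℕ) (K : Finset ℕ) (u : ℕ) : Prop where
  subset : K ⊆ Finset.range n
  isClique : H.IsClique K
  card_le : K.card ≤ k
  le_mem : ∀ v ∈ K, u ≤ v
  le : u ≤ n
  code_le : K.card < k → ∀ Q ⊆ Finset.range n, H.IsNClique k Q → code K + 2 ^ u ≤ code Q

variable {H : SimpleGraph ℕ} {n k u : ℕ} {K : Finset ℕ}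

theorem Invariant.init (H : SimpleGraph ℕ) (n k : ℕ) : Invariant H n k ∅ 0 where
  subset := by simp
  isClique := by simp
  card_le := by simp
  le_mem := by simp
  le := by simp
  code_le := by
    intro hk Q _ hQ
    obtain ⟨v, hv⟩ : Q.Nonempty := Finset.card_pos.1 (hQ.card_eq ▸ hk)
    have : 2 ^ v ≤ code Q :=
      Finset.single_le_sum (f := fun v => 2 ^ v) (fun _ _ => Nat.zero_le _) hv
    simp only [code, Finset.sum_empty, pow_zero]
    exact Nat.one_le_two_pow.trans this

theorem Invariant.erase (h : Invariant H n k K u) (hk : K.card < k) (hu : u ∈ K) :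
    Invariant H n k (K.erase u) (u + 1) where
  subset := (Finset.erase_subset _ _).trans h.subset
  isClique := h.isClique.subset (by simp)
  card_le := (Finset.card_erase_le).trans h.card_le
  le_mem v hv := by
    have := h.le_mem v (Finset.mem_of_mem_erase hv)
    have := Finset.ne_of_mem_erase hv
    omega
  le := Finset.mem_range.1 (h.subset hu)
  code_le := by
    intro _ Q hQn hQ
    have := h.code_le hk Q hQn hQ
    have := code_erase_add hu
    rw [pow_succ]
    omega

theorem Invariant.insert (h : Invariant H n k K u) (hk : K.card < k) (hn : u < n) (hu : u ∉ K)
    (hadj : ∀ v ∈ K, H.Adj v u) : Invariant H n k (insert u K) 0 where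
  subset := Finset.insert_subset (Finset.mem_range.2 hn) h.subset
  isClique := by
    rw [Finset.coe_insert]
    exact h.isClique.insert fun v hv _ => (hadj v hv).symm
  card_le := by rw [Finset.card_insert_of_notMem hu]; exact hk
  le_mem := by simp
  le := Nat.zero_le _
  code_le := by
    intro hk' Q hQn hQ
    have h₁ := h.code_le hk Q hQn hQ
    have hne : code (Insert.insert u K) ≠ code Q := by
      intro heq
      have := Finset.geomSum_injective (n := 2) le_rfl heq
      rw [this, hQ.card_eq] at hk'
      exact hk'.false
    rw [code_insert hu] at hne ⊢
    rw [pow_zero]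
    omega

theorem Invariant.skip (h : Invariant H n k K u) (hk : K.card < k) (hn : u < n) (hu : u ∉ K)
    (hadj : ¬ ∀ v ∈ K, H.Adj v u) : Invariant H n k K (u + 1) where
  subset := h.subset
  isClique := h.isClique
  card_le := h.card_le
  le_mem v hv := by
    have := h.le_mem v hv
    have : u ≠ v := by rintro rfl; exact hu hv
    omega
  le := hn
  code_le := by
    intro _ Q hQn hQ
    by_contra! hlt
    have hsub := insert_subset_of_code h.le_mem hu (h.code_le hk Q hQn hQ) hlt
    refine hadj fun v hv => hQ.isClique (hsub (Finset.mem_insert_of_mem hv))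
      (hsub (Finset.mem_insert_self _ _)) ?_
    rintro rfl
    exact hu hv

theorem Invariant.not_isNClique (h : Invariant H n k K n) (hk : K.card < k) (Q : Finset ℕ)
    (hQn : Q ⊆ Finset.range n) : ¬ H.IsNClique k Q := by
  intro hQ
  have := h.code_le hk Q hQn hQ
  have := code_lt_of_subset hQn
  omega

theorem card_filter_card_le {V : Type*} (S : Finset V) (k : ℕ) :
    (S.powerset.filter fun K => K.card ≤ k).card ≤ (S.card + 1) ^ k := by
  classical
  have hsub : (S.powerset.filter fun K => K.card ≤ k) ⊆
      (Finset.range (k + 1)).biUnion fun j => S.powersetCard j := by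
    intro K hK
    simp only [Finset.mem_filter, Finset.mem_powerset] at hK
    simp only [Finset.mem_biUnion, Finset.mem_range, Finset.mem_powersetCard]
    exact ⟨K.card, by omega, hK.1, rfl⟩
  calc (S.powerset.filter fun K => K.card ≤ k).card
      ≤ ∑ j ∈ Finset.range (k + 1), (S.powersetCard j).card :=
        (Finset.card_le_card hsub).trans Finset.card_biUnion_le
    _ ≤ ∑ j ∈ Finset.range (k + 1), S.card ^ j * 1 ^ (k - j) * k.choose j := by
        refine Finset.sum_le_sum fun j hj => ?_
        rw [Finset.card_powersetCard, one_pow, mul_one]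
        exact (Nat.choose_le_pow _ j).trans
          (Nat.le_mul_of_pos_right _ (Nat.choose_pos (Finset.mem_range_succ_iff.1 hj)))
    _ = (S.card + 1) ^ k := (add_pow S.card 1 k).symm

open Classical in
/-- The cliques of `H` inside `{0, …, m - 1}` that have at most `k` vertices. -/
noncomputable def cliques (H : SimpleGraph ℕ) (m k : ℕ) : Finset (Finset ℕ) :=
  (Finset.range m).powerset.filter fun K => H.IsClique K ∧ K.card ≤ k

/-- The order in which the pairs `(K, u)` are visited: every transition increases this number. -/
def stamp (k : ℕ) (s : Finset ℕ × ℕ) : ℕ := 2 * (code s.1 + 2 ^ s.2) + (k - s.1.card)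

/-- The number of pairs of a clique inside `{0, …, m - 1}` and a vertex `u ≤ m` that are not yet
past. -/
noncomputable def remaining (H : SimpleGraph ℕ) (m k : ℕ) (K : Finset ℕ) (u : ℕ) : ℕ :=
  ((cliques H m k ×ˢ Finset.range (m + 1)).filter fun s => stamp k (K, u) ≤ stamp k s).card

theorem remaining_le (H : SimpleGraph ℕ) (m k : ℕ) (K : Finset ℕ) (u : ℕ) :
    remaining H m k K u ≤ (cliques H m k).card * (m + 1) := by
  refine (Finset.card_filter_le _ _).trans ?_
  simp

theorem one_le_card_cliques (H : SimpleGraph ℕ) (m k : ℕ) : 1 ≤ (cliques H m k).card :=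
  Finset.card_pos.2 ⟨∅, by simp [cliques]⟩

/-- If `{0, …, m - 1}` contains a `k`-clique, then the search does not leave this set before
it succeeds. -/
theorem Invariant.mem_of_isNClique {m : ℕ} (h : Invariant H n k K u) (hk : K.card < k)
    (hmn : m ≤ n) (hm : m = n ∨ ∃ Q ⊆ Finset.range m, H.IsNClique k Q) :
    (K, u) ∈ cliques H m k ×ˢ Finset.range (m + 1) := by
  have hKu : K ⊆ Finset.range m ∧ u ≤ m := by
    rcases hm with rfl | ⟨Q, hQm, hQ⟩
    · exact ⟨h.subset, h.le⟩
    · have h₁ := h.code_le hk Q (hQm.trans (Finset.range_mono hmn)) hQ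
      have h₂ := code_lt_of_subset hQm
      refine ⟨fun v hv => Finset.mem_range.2 (lt_of_code_lt
        ((Nat.le_add_right _ _).trans_lt (h₁.trans_lt h₂)) hv), ?_⟩
      exact ((Nat.pow_lt_pow_iff_right (a := 2) (by norm_num)).1
        ((Nat.le_add_left _ _).trans_lt (h₁.trans_lt h₂))).le
  simp only [Finset.mem_product, cliques, Finset.mem_filter, Finset.mem_powerset,
    Finset.mem_range]
  exact ⟨⟨hKu.1, h.isClique, h.card_le⟩, by omega⟩

theorem Invariant.remaining_lt {m u' : ℕ} {K' : Finset ℕ} (h : Invariant H n k K u)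
    (hk : K.card < k) (hmn : m ≤ n) (hm : m = n ∨ ∃ Q ⊆ Finset.range m, H.IsNClique k Q)
    (hlt : stamp k (K, u) < stamp k (K', u')) :
    remaining H m k K' u' < remaining H m k K u := by
  apply Finset.card_lt_card
  rw [Finset.ssubset_iff_of_subset]
  · refine ⟨(K, u), ?_, ?_⟩
    · simp only [Finset.mem_filter, le_refl, and_true]
      exact h.mem_of_isNClique hk hmn hm
    · simp only [Finset.mem_filter, not_and]
      intro _
      omega
  · intro s hs
    simp only [Finset.mem_filter] at hs ⊢
    exact ⟨hs.1, hlt.le.trans hs.2⟩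

/-- Going back leaves the counter `code K + 2 ^ u` unchanged, but makes the clique smaller. -/
theorem stamp_lt_erase (hu : u ∈ K) (hk : K.card ≤ k) :
    stamp k (K, u) < stamp k (K.erase u, u + 1) := by
  have h₁ := code_erase_add hu
  have h₂ := Finset.card_erase_add_one hu
  simp only [stamp, pow_succ]
  omega

theorem stamp_lt_insert (hu : u ∉ K) (hk : K.card < k) :
    stamp k (K, u) < stamp k (insert u K, 0) := by
  simp only [stamp, code_insert hu, Finset.card_insert_of_notMem hu, pow_zero]
  omega

theorem stamp_lt_succ : stamp k (K, u) < stamp k (K, u + 1) := by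
  have := Nat.one_le_two_pow (n := u)
  simp only [stamp, pow_succ]
  omega

theorem card_cliques_le (H : SimpleGraph ℕ) (m k : ℕ) :
    (cliques H m k).card ≤ (m + 1) ^ k := by
  classical
  refine (Finset.card_le_card fun K hK => ?_).trans
    ((card_filter_card_le (Finset.range m) k).trans_eq (by rw [Finset.card_range]))
  simp only [cliques, Finset.mem_filter] at hK ⊢
  exact ⟨hK.1, hK.2.2⟩

end CliqueSearch

/-! ### The clique program -/

namespace CliqueSearch

open RAM

/-- The register that holds the entry `(v, w)` of an adjacency matrix with `n` columns that
starts at register `D`. -/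
def cell (D n v w : ℕ) : ℕ := D + v * n + w

theorem cell_inj {D n v w v' w' : ℕ} (hw : w < n) (hw' : w' < n) :
    cell D n v w = cell D n v' w' ↔ v = v' ∧ w = w' := by
  refine ⟨fun h => ?_, by rintro ⟨rfl, rfl⟩; rfl⟩
  simp only [cell] at h
  have hn : 0 < n := by omega
  have h' : w + v * n = w' + v' * n := by omega
  have h₁ := congrArg (· % n) h'
  have h₂ := congrArg (· / n) h'
  simp only [Nat.add_mul_mod_self_right, Nat.mod_eq_of_lt hw, Nat.mod_eq_of_lt hw'] at h₁
  simp only [Nat.add_mul_div_right _ _ hn, Nat.div_eq_of_lt hw, Nat.div_eq_of_lt hw',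
    Nat.zero_add] at h₂
  exact ⟨h₂, h₁⟩

theorem cell_diag_add (D n v : ℕ) : cell D n v v + (n + 1) = cell D n (v + 1) (v + 1) := by
  simp only [cell]; ring

theorem cell_add (D n v w : ℕ) : cell D n v w + n = cell D n (v + 1) w := by
  simp only [cell]; ring

/-- One round of the loop that tests whether the vertex `u` is adjacent to the current clique:
go to the next vertex, and clear the flag in register `13` if that vertex belongs to the clique
without being adjacent to `u`. -/
def checkRound : Cmd :=
  .seq (.block [.add 11 11 4, .add 12 12 1, .load 9 11])
    (.seq (.ifz 9 (.block [])
        (.seq (.block [.load 9 12]) (.ifz 9 (.block [.const 13 0]) (.block []))))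
      (.block [.sub 10 10 3]))

/-- Test whether `u` is adjacent to all vertices of the current clique, and put the result into
register `13`. -/
def check : Cmd :=
  .seq (.block [.copy 10 5, .sub 10 10 3, .copy 11 6, .copy 12 6, .const 13 1])
    (.loop 10 checkRound)

/-- One round of the search: accept, reject, go back, extend the clique, or skip a vertex.
The current clique is stored on the diagonal of the adjacency matrix, register `0` holds the number
of vertices that are still missing, register `5` the number of vertices from `u` on, and
register `6` the address of the diagonal entry of `u`. -/
def searchRound : Cmd :=
  .ifz 0 (.block [.const 0 1, .const 8 0])
    (.ifz 5 (.block [.const 0 0, .const 8 0])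
      (.seq (.block [.load 9 6])
        (.ifz 9
          (.seq check
            (.ifz 13 (.block [.add 6 6 4, .sub 5 5 3])
              (.block [.store 6 3, .sub 0 0 3, .copy 5 1, .copy 6 7])))
          (.block [.const 9 0, .store 6 9, .add 0 0 3, .add 6 6 4, .sub 5 5 3]))))

/-- Find a place for the adjacency matrix where its lower triangle does not meet the registers
below `14`, except that register `2` may hold the first diagonal entry.  For `14 ≤ n` the matrix
can stay where it is, since these registers belong to its first row.  Otherwise it is copied, by a
fixed number of instructions without any auxiliary register. -/
def relocate : Cmd :=
  .seq (.block [.const 2 14, .sub 2 2 1])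
    (.ifz 2 (.block [.const 7 2])
      (.block (.const 2 0 :: ((List.range 256).map fun i => Instr.copy (256 + i) i) ++
        [.const 7 258])))

/-- The whole algorithm as a structured program. -/
def searchCmd : Cmd :=
  .seq relocate
    (.seq (.block [.const 3 1, .add 4 1 3, .copy 5 1, .copy 6 7, .const 8 1])
      (.loop 8 searchRound))

open Classical in
/-- The memory `m` represents the state `(K, u)` of the search. -/
structure Represents (D n k : ℕ) (H : SimpleGraph ℕ) (K : Finset ℕ) (u : ℕ) (m : ℕ → ℕ) :
    Prop where
  missing : m 0 + K.card = k
  size : m 1 = n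
  one : m 3 = 1
  size_add_one : m 4 = n + 1
  rest : m 5 + u = n
  pos : m 6 = cell D n u u
  base : m 7 = cell D n 0 0
  running : m 8 = 1
  diag : ∀ v < n, m (cell D n v v) = if v ∈ K then 1 else 0
  adj : ∀ v < n, ∀ w < v, m (cell D n v w) = if H.Adj v w then 1 else 0

/-- The lower triangle of the matrix at `D` avoids the registers used for other purposes. -/
def IsSafe (D n : ℕ) : Prop := ∀ v < n, ∀ w ≤ v, cell D n v w = 2 ∨ 14 ≤ cell D n v w

variable {D n k u : ℕ} {H : SimpleGraph ℕ} {K : Finset ℕ} {m : ℕ → ℕ}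

open Classical in
/-- The memory `m` occurs in the adjacency test for `u`, started in memory `m₀`, after all
vertices up to `v` have been treated. -/
structure Checking (D n : ℕ) (H : SimpleGraph ℕ) (K : Finset ℕ) (u v : ℕ) (m₀ m : ℕ → ℕ) :
    Prop where
  le : u ≤ v
  count : m 10 + v + 1 = n
  posDiag : m 11 = cell D n v v
  pos : m 12 = cell D n v u
  flag : m 13 = if ∀ x ∈ K, x ≤ v → H.Adj x u then 1 else 0
  frame : ∀ a, a < 9 ∨ 13 < a → m a = m₀ a

open Classical in
theorem Checking.round {v : ℕ} {m₀ : ℕ → ℕ} (hD : IsSafe D n) (h₀ : Represents D n k H K u m₀)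
    (h : Checking D n H K u v m₀ m) (hm : m 10 ≠ 0) :
    Runs checkRound m 10 (Checking D n H K u (v + 1) m₀) := by
  have hvn : v + 1 < n := by have := h.count; omega
  have h1 : m 1 = n := (h.frame 1 (by omega)).trans h₀.size
  have h3 : m 3 = 1 := (h.frame 3 (by omega)).trans h₀.one
  have h4 : m 4 = n + 1 := (h.frame 4 (by omega)).trans h₀.size_add_one
  have hs₁ := hD (v + 1) hvn (v + 1) le_rfl
  have hs₂ := hD (v + 1) hvn u (h.le.trans (Nat.le_succ v))
  have hdiag := (h.frame (cell D n (v + 1) (v + 1)) (by omega)).trans (h₀.diag (v + 1) hvn)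
  have hadj := (h.frame (cell D n (v + 1) u) (by omega)).trans
    (h₀.adj (v + 1) hvn u (Nat.lt_succ_of_le h.le))
  have hflag : (∀ x ∈ K, x ≤ v + 1 → H.Adj x u) ↔
      (∀ x ∈ K, x ≤ v → H.Adj x u) ∧ (v + 1 ∈ K → H.Adj (v + 1) u) := by
    constructor
    · exact fun h => ⟨fun x hx hxv => h x hx (by omega), fun hv => h _ hv le_rfl⟩
    · rintro ⟨h₁, h₂⟩ x hx hxv
      rcases Nat.lt_or_eq_of_le hxv with h | rfl
      · exact h₁ x hx (by omega)
      · exact h₂ hx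
  have hf := h.flag
  have hcount := h.count
  have hle := h.le
  have h11 := h.posDiag
  have h12 := h.pos
  have hfr := h.frame
  have e₁ := cell_diag_add D n v
  have e₂ := cell_add D n v u
  refine Runs.seq (S := 3) (T := 7) (.block (by decide) le_rfl ?_)
  refine Runs.seq (S := 6) (T := 1) (.ifz (T := 4) (fun hz => ?_) fun hz => ?_)
  · refine .block (by decide) (by simp) (.block (by decide) le_rfl ?_)
    simp (disch := omega) only [List.foldl, Instr.act, Function.update_of_ne,
        Function.update_self, h1, h3, h4, h11, h12, e₁, e₂, hdiag, hadj] at hz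
    have hb : v + 1 ∉ K := by simpa using hz
    constructor
    · omega
    · simp (disch := omega) only [List.foldl, Instr.act, Function.update_of_ne,
        Function.update_self, h1, h3, h4, h11, h12, e₁, e₂, hdiag, hadj]
      omega
    · simp (disch := omega) only [List.foldl, Instr.act, Function.update_of_ne,
        Function.update_self, h1, h3, h4, h11, h12, e₁, e₂, hdiag, hadj]
    · simp (disch := omega) only [List.foldl, Instr.act, Function.update_of_ne,
        Function.update_self, h1, h3, h4, h11, h12, e₁, e₂, hdiag, hadj]
    · simp (disch := omega) only [List.foldl, Instr.act, Function.update_of_ne,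
        Function.update_self, h1, h3, h4, h11, h12, e₁, e₂, hdiag, hadj]
      rw [if_congr hflag rfl rfl, hf]
      simp [hb]
    · intro a ha
      rw [← hfr a ha]
      simp only [List.foldl, Instr.act]
      repeat refine (Function.update_of_ne (by omega) _ _).trans ?_
      rfl
  · simp (disch := omega) only [List.foldl, Instr.act, Function.update_of_ne,
        Function.update_self, h1, h3, h4, h11, h12, e₁, e₂, hdiag, hadj] at hz
    have hb : v + 1 ∈ K := by simpa using hz
    refine .seq (S := 1) (T := 3) (.block (by decide) le_rfl ?_)
    refine .ifz (T := 1) (fun hz' => ?_) fun hz' => ?_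
    · simp (disch := omega) only [List.foldl, Instr.act, Function.update_of_ne,
        Function.update_self, h1, h3, h4, h11, h12, e₁, e₂, hdiag, hadj] at hz'
      have hc : ¬ H.Adj (v + 1) u := by simpa using hz'
      refine .block (by decide) le_rfl (.block (by decide) le_rfl ?_)
      constructor
      · omega
      · simp (disch := omega) only [List.foldl, Instr.act, Function.update_of_ne,
        Function.update_self, h1, h3, h4, h11, h12, e₁, e₂, hdiag, hadj]
        omega
      · simp (disch := omega) only [List.foldl, Instr.act, Function.update_of_ne,
        Function.update_self, h1, h3, h4, h11, h12, e₁, e₂, hdiag, hadj]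
      · simp (disch := omega) only [List.foldl, Instr.act, Function.update_of_ne,
        Function.update_self, h1, h3, h4, h11, h12, e₁, e₂, hdiag, hadj]
      · simp (disch := omega) only [List.foldl, Instr.act, Function.update_of_ne,
        Function.update_self, h1, h3, h4, h11, h12, e₁, e₂, hdiag, hadj]
        rw [if_congr hflag rfl rfl]
        simp [hb, hc]
      · intro a ha
        rw [← hfr a ha]
        simp only [List.foldl, Instr.act]
        repeat refine (Function.update_of_ne (by omega) _ _).trans ?_
        rfl
    · simp (disch := omega) only [List.foldl, Instr.act, Function.update_of_ne,
        Function.update_self, h1, h3, h4, h11, h12, e₁, e₂, hdiag, hadj] at hz'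
      have hc : H.Adj (v + 1) u := by simpa using hz'
      refine .block (by decide) (by simp) (.block (by decide) le_rfl ?_)
      constructor
      · omega
      · simp (disch := omega) only [List.foldl, Instr.act, Function.update_of_ne,
        Function.update_self, h1, h3, h4, h11, h12, e₁, e₂, hdiag, hadj]
        omega
      · simp (disch := omega) only [List.foldl, Instr.act, Function.update_of_ne,
        Function.update_self, h1, h3, h4, h11, h12, e₁, e₂, hdiag, hadj]
      · simp (disch := omega) only [List.foldl, Instr.act, Function.update_of_ne,
        Function.update_self, h1, h3, h4, h11, h12, e₁, e₂, hdiag, hadj]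
      · simp (disch := omega) only [List.foldl, Instr.act, Function.update_of_ne,
        Function.update_self, h1, h3, h4, h11, h12, e₁, e₂, hdiag, hadj]
        rw [if_congr hflag rfl rfl, hf]
        simp [hb, hc]
      · intro a ha
        rw [← hfr a ha]
        simp only [List.foldl, Instr.act]
        repeat refine (Function.update_of_ne (by omega) _ _).trans ?_
        rfl

theorem Represents.congr {m' : ℕ → ℕ} (hD : IsSafe D n) (h : Represents D n k H K u m)
    (hm : ∀ a, a < 9 ∨ 13 < a → m' a = m a) : Represents D n k H K u m' where
  missing := by rw [hm 0 (by omega), h.missing]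
  size := by rw [hm 1 (by omega), h.size]
  one := by rw [hm 3 (by omega), h.one]
  size_add_one := by rw [hm 4 (by omega), h.size_add_one]
  rest := by rw [hm 5 (by omega), h.rest]
  pos := by rw [hm 6 (by omega), h.pos]
  base := by rw [hm 7 (by omega), h.base]
  running := by rw [hm 8 (by omega), h.running]
  diag v hv := by
    have := hD v hv v le_rfl
    rw [hm _ (by omega), h.diag v hv]
  adj v hv w hw := by
    have := hD v hv w hw.le
    rw [hm _ (by omega), h.adj v hv w hw]

theorem cell_ne_of_ne (hu : u < n) {v w : ℕ} (hw : w < n) (h : v ≠ u ∨ w ≠ u) :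
    cell D n v w ≠ cell D n u u := by
  rw [Ne, cell_inj hw hu]
  omega

theorem Represents.skip (hD : IsSafe D n) (h : Represents D n k H K u m) (hu : u < n) :
    Represents D n k H K (u + 1) ([Instr.add 6 6 4, .sub 5 5 3].foldl Instr.act m) := by
  have h0 := h.missing
  have h1 := h.size
  have h3 := h.one
  have h4 := h.size_add_one
  have h5 := h.rest
  have h6 := h.pos
  have h7 := h.base
  have h8 := h.running
  have e₁ := cell_diag_add D n u
  constructor
  case diag =>
    intro v hv
    have := hD v hv v le_rfl
    rw [← h.diag v hv]
    simp (disch := omega) only [List.foldl, Instr.act, Function.update_of_ne, Function.update_self, h1, h3, h4, h6, h7, h8, e₁]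
  case adj =>
    intro v hv w hw
    have := hD v hv w hw.le
    rw [← h.adj v hv w hw]
    simp (disch := omega) only [List.foldl, Instr.act, Function.update_of_ne, Function.update_self, h1, h3, h4, h6, h7, h8, e₁]
  all_goals simp (disch := omega) only [List.foldl, Instr.act, Function.update_of_ne, Function.update_self, h1, h3, h4, h6, h7, h8, e₁]
  all_goals omega

theorem Represents.insert (hD : IsSafe D n) (h : Represents D n k H K u m) (hu : u < n)
    (hk : K.card < k) (huK : u ∉ K) : Represents D n k H (insert u K) 0
      ([Instr.store 6 3, .sub 0 0 3, .copy 5 1, .copy 6 7].foldl Instr.act m) := by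
  have h0 := h.missing
  have h1 := h.size
  have h3 := h.one
  have h4 := h.size_add_one
  have h5 := h.rest
  have h6 := h.pos
  have h7 := h.base
  have h8 := h.running
  have e₁ := cell_diag_add D n u
  have hs := hD u hu u le_rfl
  have hcard := Finset.card_insert_of_notMem huK
  constructor
  case diag =>
    intro v hv
    have := hD v hv v le_rfl
    by_cases hvu : v = u
    · subst hvu
      simp (disch := omega) only [List.foldl, Instr.act, Function.update_of_ne, Function.update_self, h1, h3, h4, h6, h7, h8, e₁]
      simp
    · have := cell_ne_of_ne (D := D) hu hv (Or.inl hvu)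
      simp (disch := omega) only [List.foldl, Instr.act, Function.update_of_ne, Function.update_self, h1, h3, h4, h6, h7, h8, e₁]
      rw [h.diag v hv]
      simp [hvu]
  case adj =>
    intro v hv w hw
    have := hD v hv w hw.le
    have := cell_ne_of_ne (D := D) hu (hw.trans hv) (show v ≠ u ∨ w ≠ u by omega)
    rw [← h.adj v hv w hw]
    simp (disch := omega) only [List.foldl, Instr.act, Function.update_of_ne, Function.update_self, h1, h3, h4, h6, h7, h8, e₁]
  all_goals simp (disch := omega) only [List.foldl, Instr.act, Function.update_of_ne, Function.update_self, h1, h3, h4, h6, h7, h8, e₁]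
  all_goals omega

theorem Represents.erase (hD : IsSafe D n) (h : Represents D n k H K u m) (hu : u < n)
    (huK : u ∈ K) : Represents D n k H (K.erase u) (u + 1)
      ([Instr.const 9 0, .store 6 9, .add 0 0 3, .add 6 6 4, .sub 5 5 3].foldl Instr.act m) := by
  have h0 := h.missing
  have h1 := h.size
  have h3 := h.one
  have h4 := h.size_add_one
  have h5 := h.rest
  have h6 := h.pos
  have h7 := h.base
  have h8 := h.running
  have e₁ := cell_diag_add D n u
  have hs := hD u hu u le_rfl
  have hcard := Finset.card_erase_add_one huK
  constructor
  case diag =>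
    intro v hv
    have := hD v hv v le_rfl
    by_cases hvu : v = u
    · subst hvu
      simp (disch := omega) only [List.foldl, Instr.act, Function.update_of_ne, Function.update_self, h1, h3, h4, h6, h7, h8, e₁]
      simp
    · have := cell_ne_of_ne (D := D) hu hv (Or.inl hvu)
      simp (disch := omega) only [List.foldl, Instr.act, Function.update_of_ne, Function.update_self, h1, h3, h4, h6, h7, h8, e₁]
      rw [h.diag v hv]
      simp [hvu]
  case adj =>
    intro v hv w hw
    have := hD v hv w hw.le
    have := cell_ne_of_ne (D := D) hu (hw.trans hv) (show v ≠ u ∨ w ≠ u by omega)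
    rw [← h.adj v hv w hw]
    simp (disch := omega) only [List.foldl, Instr.act, Function.update_of_ne, Function.update_self, h1, h3, h4, h6, h7, h8, e₁]
  all_goals simp (disch := omega) only [List.foldl, Instr.act, Function.update_of_ne, Function.update_self, h1, h3, h4, h6, h7, h8, e₁]
  all_goals omega

open Classical in
theorem Represents.check (hD : IsSafe D n) (h : Represents D n k H K u m) (hu : u < n)
    (huK : u ∉ K) (hle : ∀ v ∈ K, u ≤ v) (hK : K ⊆ Finset.range n) :
    Runs check m (12 * n + 6) fun m' => Represents D n k H K u m' ∧
        m' 13 = if ∀ v ∈ K, H.Adj v u then 1 else 0 := by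
  have h0 := h.missing
  have h1 := h.size
  have h3 := h.one
  have h5 := h.rest
  have h6 := h.pos
  have e₁ := cell_diag_add D n u
  refine (Runs.seq (S := 5) (T := (n - u - 1) * (10 + 2) + 1) (.block (by decide) le_rfl
    (Runs.loop (fun j m' => ∃ v, j + v + 1 = n ∧ Checking D n H K u v m m') ?_ ?_ _ _
      ⟨u, ?_, ?_⟩))).mono (by omega) fun _ h => h
  · rintro j m' ⟨v, hj, hv⟩ hz
    have hvn : v + 1 = n := by have := hv.count; omega
    refine ⟨h.congr hD hv.frame, ?_⟩
    rw [hv.flag]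
    refine if_congr (forall₂_congr fun x hx => ?_) rfl rfl
    have := Finset.mem_range.1 (hK hx)
    simp [show x ≤ v by omega]
  · rintro j m' ⟨v, hj, hv⟩ hz
    have := hv.count
    exact ⟨j - 1, by omega, (hv.round hD h hz).mono le_rfl fun m'' h'' =>
      ⟨v + 1, by omega, h''⟩⟩
  · omega
  · constructor
    case frame =>
      intro a ha
      simp only [List.foldl, Instr.act]
      repeat refine (Function.update_of_ne (by omega) _ _).trans ?_
      rfl
    case flag =>
      have : ∀ x ∈ K, x ≤ u → H.Adj x u := by
        intro x hx hxu
        have := hle x hx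
        have : x = u := by omega
        exact absurd (this ▸ hx) huK
      rw [if_pos this]
      simp (disch := omega) only [List.foldl, Instr.act, Function.update_of_ne,
        Function.update_self]
    all_goals try simp (disch := omega) only [List.foldl, Instr.act, Function.update_of_ne,
        Function.update_self, h3, h6]
    all_goals omega

/-- The search has halted with the right answer in register `0`. -/
def Finished (n k : ℕ) (H : SimpleGraph ℕ) (m : ℕ → ℕ) : Prop :=
  m 8 = 0 ∧ (m 0 ≠ 0 ↔ ∃ Q ⊆ Finset.range n, H.IsNClique k Q)

theorem Represents.round (hD : IsSafe D n) (h : Represents D n k H K u m)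
    (hI : Invariant H n k K u) :
    Runs searchRound m (12 * n + 19) fun m' => Finished n k H m' ∨ (K.card < k ∧
      ∃ K' u', Represents D n k H K' u' m' ∧ Invariant H n k K' u' ∧
        stamp k (K, u) < stamp k (K', u')) := by
  refine Runs.ifz (T := 12 * n + 17) (fun hz => ?_) fun hz => ?_
  · refine .block (by decide) (by simp) (.inl ⟨by simp [Instr.act], ?_⟩)
    have : K.card = k := by have := h.missing; omega
    simpa [Instr.act] using ⟨K, hI.subset, hI.isClique, this⟩
  have hk : K.card < k := by have := h.missing; omega
  refine Runs.ifz (T := 12 * n + 15) (fun hz => ?_) fun hz => ?_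
  · refine .block (by decide) (by simp) (.inl ⟨by simp [Instr.act], ?_⟩)
    obtain rfl : u = n := by have := h.rest; omega
    simpa [Instr.act] using hI.not_isNClique hk
  have hu : u < n := by have := h.rest; omega
  have hs := hD u hu u le_rfl
  refine (Runs.seq (S := 1) (T := 12 * n + 14) (.block (by decide) le_rfl ?_)).mono (by omega)
    fun _ h => h
  have h' : Represents D n k H K u ([Instr.load 9 6].foldl Instr.act m) := by
    refine h.congr hD fun a ha => ?_
    simp only [List.foldl, Instr.act]
    exact Function.update_of_ne (by omega) _ _
  have h9 : [Instr.load 9 6].foldl Instr.act m 9 = if u ∈ K then 1 else 0 := by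
    simp [Instr.act, h.pos, h.diag u hu]
  generalize [Instr.load 9 6].foldl Instr.act m = m' at h' h9
  refine Runs.ifz (T := 12 * n + 12) (fun hz => ?_) fun hz => ?_
  · have huK : u ∉ K := by simpa [h9] using hz
    have hc := h'.check hD hu huK hI.le_mem hI.subset
    refine Runs.seq (S := 12 * n + 6) (T := 6) (hc.mono le_rfl ?_)
    rintro m'' ⟨h'', hflag⟩
    refine Runs.ifz (T := 4) (fun hz => ?_) fun hz => ?_
    · have hadj : ¬ ∀ v ∈ K, H.Adj v u := by
        intro hadj
        rw [if_pos hadj] at hflag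
        omega
      exact .block (by decide) (by simp) (.inr ⟨hk, _, _, h''.skip hD hu,
        hI.skip hk hu huK hadj, stamp_lt_succ⟩)
    · have hadj : ∀ v ∈ K, H.Adj v u := by
        by_contra hadj
        rw [if_neg hadj] at hflag
        exact hz hflag
      exact .block (by decide) (by simp) (.inr ⟨hk, _, _, h''.insert hD hu hk huK,
        hI.insert hk hu huK hadj, stamp_lt_insert huK hk⟩)
  · have huK : u ∈ K := by simpa [h9] using hz
    exact .block (by decide) (by simp) (.inr ⟨hk, _, _, h'.erase hD hu huK, hI.erase hk huK,
      stamp_lt_erase huK hk.le⟩)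

/-! ### Correctness and running time of the program -/

theorem Represents.runs_loop {b : ℕ} (hD : IsSafe D n) (h : Represents D n k H ∅ 0 m)
    (hbn : b ≤ n) (hb : b = n ∨ ∃ Q ⊆ Finset.range b, H.IsNClique k Q) :
    Runs (.loop 8 searchRound) m (((cliques H b k).card * (b + 1) + 1) * (12 * n + 21) + 1)
      (Finished n k H) := by
  refine Runs.loop (T := 12 * n + 19) (fun j m => Finished n k H m ∨ ∃ K u,
    Represents D n k H K u m ∧ Invariant H n k K u ∧ remaining H b k K u + 1 ≤ j) ?_ ?_ _ _
      (.inr ⟨∅, 0, h, .init H n k, Nat.succ_le_succ (remaining_le H b k ∅ 0)⟩)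
  · rintro j m (hm | ⟨K, u, hR, hI, hj⟩) hz
    · exact hm
    · have := hR.running
      omega
  · rintro j m (hm | ⟨K, u, hR, hI, hj⟩) hz
    · exact absurd hm.1 hz
    · refine ⟨j - 1, by omega, (hR.round hD hI).mono le_rfl ?_⟩
      rintro m' (hm' | ⟨hk, K', u', hR', hI', hlt⟩)
      · exact .inl hm'
      · have := hI.remaining_lt hk hbn hb hlt
        exact .inr ⟨K', u', hR', hI', by omega⟩

theorem foldl_copy (m : ℕ → ℕ) (s N : ℕ) (hN : N ≤ s) :
    ((List.range N).map fun i => Instr.copy (s + i) i).foldl Instr.act m =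
      fun a => if s ≤ a ∧ a < s + N then m (a - s) else m a := by
  induction N with
  | zero =>
    funext a
    simp [show ¬ (s ≤ a ∧ a < s) by omega]
  | succ N ih =>
    rw [List.range_succ, List.map_append, List.foldl_append, ih (by omega)]
    funext a
    simp only [List.map_cons, List.map_nil, List.foldl, Instr.act, Function.update_apply]
    by_cases ha : a = s + N
    · subst ha
      simp [show ¬ (s ≤ N) by omega]
    · have : (s ≤ a ∧ a < s + N) ↔ (s ≤ a ∧ a < s + (N + 1)) := by omega
      simp only [if_neg ha, this]

/-- The graph `G` on the vertices `0, 1, …, n - 1` as a graph on all natural numbers. -/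
abbrev toNat {n : ℕ} (G : SimpleGraph (Fin n)) : SimpleGraph ℕ := G.map Fin.valEmbedding

theorem toNat_adj {n : ℕ} {G : SimpleGraph (Fin n)} {v w : ℕ} :
    (toNat G).Adj v w ↔ ∃ (i j : Fin n), G.Adj i j ∧ (i : ℕ) = v ∧ (j : ℕ) = w := by
  simp [SimpleGraph.map_adj]

open Classical in
theorem inputMem_cell {n : ℕ} (G : SimpleGraph (Fin n)) (k : ℕ) {v w : ℕ} (hw : w < n) :
    Clique.inputMem G k (2 + v * n + w) = if (toNat G).Adj v w then 1 else 0 := by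
  rw [Clique.inputMem, if_neg (by omega), if_neg (by omega)]
  refine if_congr ?_ rfl rfl
  rw [toNat_adj]
  constructor
  · rintro ⟨i, j, h, hij⟩
    obtain ⟨h₁, h₂⟩ := (cell_inj (D := 2) hw j.2).1 h
    exact ⟨i, j, hij, h₁.symm, h₂.symm⟩
  · rintro ⟨i, j, hij, rfl, rfl⟩
    exact ⟨i, j, rfl, hij⟩

/-- After `relocate`, the lower triangle of the adjacency matrix (the part that the search uses)
is intact, at a place where the auxiliary registers do not overwrite it. -/
theorem runs_relocate {n : ℕ} (G : SimpleGraph (Fin n)) (k : ℕ) :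
    Runs relocate (Clique.inputMem G k) 300 fun m => ∃ D, IsSafe D n ∧ m 0 = k ∧ m 1 = n ∧ m 7 = D ∧
      ∀ v < n, ∀ w ≤ v, m (cell D n v w) = Clique.inputMem G k (2 + v * n + w) := by
  have h0 : Clique.inputMem G k 0 = k := by simp [Clique.inputMem]
  have h1 : Clique.inputMem G k 1 = n := by simp [Clique.inputMem]
  have h2 : 0 < n → Clique.inputMem G k 2 = 0 := fun hn => by
    simpa using inputMem_cell G k (v := 0) hn
  refine Runs.seq (S := 2) (T := 298) (.block (by decide) le_rfl ?_)
  have hm : [Instr.const 2 14, .sub 2 2 1].foldl Instr.act (Clique.inputMem G k) =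
      Function.update (Clique.inputMem G k) 2 (14 - n) := by
    simp [Instr.act, h1]
  rw [hm]
  refine Runs.ifz (T := 296) (fun hz => ?_) fun hz => ?_
  · have hn : 14 ≤ n := by
      simp only [Function.update_self] at hz
      omega
    refine .block (by decide) (by simp) ⟨2, ?_, ?_, ?_, ?_, ?_⟩
    · intro v hv w hw
      rcases Nat.eq_zero_or_pos v with rfl | hv₀
      · simp only [cell]
        omega
      · have : n ≤ v * n := Nat.le_mul_of_pos_left n hv₀
        simp only [cell]
        omega
    · simp [Instr.act, h0]
    · simp [Instr.act, h1]
    · simp [Instr.act]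
    · intro v hv w hw
      simp only [List.foldl, Instr.act]
      change Function.update (Function.update (Clique.inputMem G k) 2 (14 - n)) 7 2
        (2 + v * n + w) = _
      rcases Nat.eq_zero_or_pos v with rfl | hv₀
      · obtain rfl : w = 0 := by omega
        simp [h2 (by omega)]
        omega
      · have : n ≤ v * n := Nat.le_mul_of_pos_left n hv₀
        rw [Function.update_of_ne (by omega), Function.update_of_ne (by omega)]
  · have hn : n < 14 := by
      simp only [Function.update_self] at hz
      omega
    have hl : ∀ i ∈ (Instr.const 2 0 :: ((List.range 256).map fun i => Instr.copy (256 + i) i) ++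
        [.const 7 258]), i.IsStraight := by
      intro i hi
      simp only [List.cons_append, List.mem_cons, List.mem_append, List.mem_map,
        List.not_mem_nil, or_false] at hi
      rcases hi with rfl | ⟨j, -, rfl⟩ | rfl <;> exact trivial
    refine .block hl (by simp) ⟨258, ?_, ?_⟩
    · intro v hv w hw
      simp only [cell]
      omega
    · rw [List.cons_append, List.foldl_cons, List.foldl_append, foldl_copy _ _ _ le_rfl]
      refine ⟨?_, ?_, ?_, ?_⟩
      · simp [Instr.act, h0]
      · simp [Instr.act, h1]
      · simp [Instr.act]
      · intro v hv w hw
        have hvn : v * n ≤ 13 * 13 := Nat.mul_le_mul (by omega) (by omega)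
        simp only [List.foldl, Instr.act, cell]
        rw [Function.update_of_ne (by omega), if_pos (by omega),
          show 258 + v * n + w - 256 = 2 + v * n + w by omega]
        by_cases h : 2 + v * n + w = 2
        · rw [h, h2 (by omega)]
          simp
        · rw [Function.update_of_ne h, Function.update_of_ne h]

theorem runs_searchCmd {n : ℕ} (G : SimpleGraph (Fin n)) (k b : ℕ) (hbn : b ≤ n)
    (hb : b = n ∨ ∃ Q ⊆ Finset.range b, (toNat G).IsNClique k Q) :
    Runs searchCmd (Clique.inputMem G k)
      (306 + ((cliques (toNat G) b k).card * (b + 1) + 1) * (12 * n + 21))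
      (Finished n k (toNat G)) := by
  refine (Runs.seq (S := 300)
    (T := 5 + (((cliques (toNat G) b k).card * (b + 1) + 1) * (12 * n + 21) + 1))
    ((runs_relocate G k).mono le_rfl ?_)).mono (by omega) fun _ h => h
  rintro m ⟨D, hD, h0, h1, h7, hcell⟩
  refine Runs.seq (.block (by decide) le_rfl (Represents.runs_loop hD ?_ hbn hb))
  constructor
  case diag =>
    intro v hv
    have := hD v hv v le_rfl
    simp (disch := omega) only [List.foldl, Instr.act, Function.update_of_ne]
    rw [hcell v hv v le_rfl, inputMem_cell G k hv]
    simp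
  case adj =>
    intro v hv w hw
    have := hD v hv w hw.le
    simp (disch := omega) only [List.foldl, Instr.act, Function.update_of_ne]
    rw [hcell v hv w hw.le, inputMem_cell G k (hw.trans hv)]
    split_ifs <;> rfl
  all_goals simp [Instr.act, h0, h1, h7, cell]

theorem exists_map_eq_of_isClique {n : ℕ} {G : SimpleGraph (Fin n)} {Q : Finset ℕ}
    (hQn : Q ⊆ Finset.range n) (hQ : (toNat G).IsClique Q) :
    ∃ S : Finset (Fin n), S.map Fin.valEmbedding = Q ∧ G.IsClique S := by
  refine ⟨Finset.univ.filter fun i : Fin n => (i : ℕ) ∈ Q, ?_, ?_⟩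
  · ext v
    simp only [Finset.mem_map, Finset.mem_filter, Finset.mem_univ, true_and]
    constructor
    · rintro ⟨i, hi, rfl⟩
      exact hi
    · exact fun hv => ⟨⟨v, Finset.mem_range.1 (hQn hv)⟩, hv, rfl⟩
  · intro i hi j hj hij
    have := hQ (by simpa using hi) (by simpa using hj) (Fin.val_ne_of_ne hij)
    exact (SimpleGraph.map_adj_apply (f := Fin.valEmbedding)).1 this

theorem exists_isNClique_toNat {n : ℕ} (G : SimpleGraph (Fin n)) (k : ℕ) :
    (∃ Q ⊆ Finset.range n, (toNat G).IsNClique k Q) ↔ ∃ S : Finset (Fin n), G.IsNClique k S := by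
  constructor
  · rintro ⟨Q, hQn, hQ⟩
    obtain ⟨S, rfl, hS⟩ := exists_map_eq_of_isClique hQn hQ.isClique
    exact ⟨S, hS, by rw [← hQ.card_eq, Finset.card_map]⟩
  · rintro ⟨S, hS⟩
    exact ⟨S.map Fin.valEmbedding, fun v hv => by
      obtain ⟨i, -, rfl⟩ := Finset.mem_map.1 hv
      exact Finset.mem_range.2 i.2, hS.map⟩

/-- The algorithm as a program of the random access machine. -/
def program : Program := searchCmd.compile 0

theorem decides_program : Clique.Decides program := by
  intro n G k
  obtain ⟨t, -, hh, hf⟩ := (runs_searchCmd G k n le_rfl (.inl rfl)).exists_halted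
  exact ⟨t, hh, hf.2.trans (exists_isNClique_toNat G k)⟩

/-- The running time is controlled by the number of small cliques inside any initial segment of the
vertices that contains a `k`-clique. -/
theorem time_program_le {n : ℕ} (G : SimpleGraph (Fin n)) (k b : ℕ) (hbn : b ≤ n)
    (hb : b = n ∨ ∃ Q ⊆ Finset.range b, (toNat G).IsNClique k Q) :
    Clique.time program G k ≤ 400 * (n + 1) ^ 2 * (cliques (toNat G) b k).card := by
  obtain ⟨t, ht, hh, -⟩ := (runs_searchCmd G k b hbn hb).exists_halted
  have h₁ : Clique.time program G k ≤ t := Nat.sInf_le hh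
  have h₂ := one_le_card_cliques (toNat G) b k
  generalize (cliques (toNat G) b k).card = N at *
  have h₃ : N * (b + 1) + 1 ≤ N * (n + 2) := by nlinarith
  calc Clique.time program G k ≤ 306 + (N * (b + 1) + 1) * (12 * n + 21) := h₁.trans ht
    _ ≤ 306 * N + N * (n + 2) * (12 * n + 21) := by gcongr; omega
    _ ≤ 400 * (n + 1) ^ 2 * N := by nlinarith [Nat.zero_le (N * n), Nat.zero_le (N * n ^ 2)]

end CliqueSearch

/-! ### Edge events in binomial random graphs -/

namespace SimpleGraph

section Edges

variable {V : Type*} [Finite V]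

theorem measurableSet_of_finite (S : Set (SimpleGraph V)) : MeasurableSet S :=
  measurableEmbedding_edgeSet.measurableSet_image.1 .of_discrete

/-- Every given set of edges is present with the expected probability. -/
theorem binomialRandom_real_subset_edgeSet (p : I) (F : Finset (Sym2 V))
    (hF : ∀ e ∈ F, ¬ e.IsDiag) :
    (binomialRandom V p).real {G | (F : Set (Sym2 V)) ⊆ G.edgeSet} = (p : ℝ) ^ F.card := by
  have hpre : (fromEdgeSet : Set (Sym2 V) → SimpleGraph V) ⁻¹'
      {G | (F : Set (Sym2 V)) ⊆ G.edgeSet} = {s | (F : Set (Sym2 V)) ⊆ s} := by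
    ext s
    simp only [Set.mem_preimage, Set.mem_ofPred_eq, edgeSet_fromEdgeSet]
    exact ⟨fun h => h.trans Set.sdiff_subset, fun h e he => ⟨h he, hF e he⟩⟩
  have hpi : (fun q : Sym2 V → Prop => {e | q e}) ⁻¹' {s | (F : Set (Sym2 V)) ⊆ s} =
      Set.pi F fun _ => {True} := by
    ext q
    simp [Set.subset_def, Set.pi]
  rw [measureReal_def, binomialRandom_eq_map,
    Measure.map_apply measurable_fromEdgeSet (measurableSet_of_finite _), hpre,
    ProbabilityTheory.setBernoulli_eq_map, Measure.map_apply _ .of_discrete, hpi,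
    Measure.infinitePi_pi _ fun _ _ => .of_discrete]
  · rw [Finset.prod_congr rfl (g := fun _ => (toNNReal p : ℝ≥0∞))]
    · simp
    · intro e he
      simp [hF e he]
  · exact MeasurableEquiv.setOfPred.measurable

/-- Disjoint sets of edges are present independently of each other, so that the probability that
none of them is completely present is a product. -/
theorem binomialRandom_real_forall_not_subset {ι : Type*} (p : I) (T : Finset ι)
    (F : ι → Finset (Sym2 V)) (hF : ∀ i ∈ T, ∀ e ∈ F i, ¬ e.IsDiag)
    (hd : (T : Set ι).PairwiseDisjoint F) (E : Finset (Sym2 V)) (hE : ∀ e ∈ E, ¬ e.IsDiag)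
    (hEF : ∀ i ∈ T, Disjoint E (F i)) :
    (binomialRandom V p).real {G | (E : Set (Sym2 V)) ⊆ G.edgeSet ∧
      ∀ i ∈ T, ¬ (F i : Set (Sym2 V)) ⊆ G.edgeSet} =
      (p : ℝ) ^ E.card * ∏ i ∈ T, (1 - (p : ℝ) ^ (F i).card) := by
  classical
  induction T using Finset.induction_on generalizing E with
  | empty => simpa using binomialRandom_real_subset_edgeSet p E hE
  | insert j T hj ih =>
    have hF' : ∀ i ∈ T, ∀ e ∈ F i, ¬ e.IsDiag := fun i hi => hF i (Finset.mem_insert_of_mem hi)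
    have hd' : (T : Set ι).PairwiseDisjoint F :=
      hd.subset (Finset.coe_subset.2 (Finset.subset_insert j T))
    have hEj : Disjoint E (F j) := hEF j (Finset.mem_insert_self j T)
    have h₁ := ih hF' hd' E hE fun i hi => hEF i (Finset.mem_insert_of_mem hi)
    have h₂ := ih hF' hd' (E ∪ F j)
      (fun e he => (Finset.mem_union.1 he).elim (hE e) (hF j (Finset.mem_insert_self j T) e))
      (fun i hi => Finset.disjoint_union_left.2 ⟨hEF i (Finset.mem_insert_of_mem hi),
        hd (Finset.mem_insert_self j T) (Finset.mem_insert_of_mem hi)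
          (by rintro rfl; exact hj hi)⟩)
    have hset : {G : SimpleGraph V | (E : Set (Sym2 V)) ⊆ G.edgeSet ∧
        ∀ i ∈ insert j T, ¬ (F i : Set (Sym2 V)) ⊆ G.edgeSet} =
        {G | (E : Set (Sym2 V)) ⊆ G.edgeSet ∧ ∀ i ∈ T, ¬ (F i : Set (Sym2 V)) ⊆ G.edgeSet} \
        {G | ((E ∪ F j : Finset (Sym2 V)) : Set (Sym2 V)) ⊆ G.edgeSet ∧
          ∀ i ∈ T, ¬ (F i : Set (Sym2 V)) ⊆ G.edgeSet} := by
      ext G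
      simp only [Finset.mem_insert, forall_eq_or_imp, Set.mem_ofPred_eq, Finset.coe_union,
        Set.union_subset_iff, Set.mem_sdiff]
      tauto
    rw [hset, measureReal_sdiff _ (measurableSet_of_finite _), h₁, h₂,
      Finset.card_union_of_disjoint hEj, Finset.prod_insert hj, pow_add]
    · ring
    · rintro G ⟨h, h'⟩
      rw [Finset.coe_union, Set.union_subset_iff] at h
      exact ⟨h.1, h'⟩

end Edges

section CompleteEdges

variable {V : Type*} [DecidableEq V]

/-- The edges of the complete graph on a finite set of vertices. -/
noncomputable def completeEdges (B : Finset V) : Finset (Sym2 V) :=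
  B.offDiag.image Sym2.mk.uncurry

theorem mem_completeEdges {B : Finset V} {v w : V} :
    s(v, w) ∈ completeEdges B ↔ v ∈ B ∧ w ∈ B ∧ v ≠ w := by
  simp only [completeEdges, Finset.mem_image, Finset.mem_offDiag, Prod.exists,
    Function.uncurry_apply_pair, Sym2.eq_iff]
  constructor
  · rintro ⟨a, b, ⟨ha, hb, hab⟩, ⟨rfl, rfl⟩ | ⟨rfl, rfl⟩⟩
    · exact ⟨ha, hb, hab⟩
    · exact ⟨hb, ha, hab.symm⟩
  · exact fun h => ⟨v, w, h, .inl ⟨rfl, rfl⟩⟩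

theorem card_completeEdges (B : Finset V) : (completeEdges B).card = B.card.choose 2 :=
  Sym2.card_image_offDiag B

theorem not_isDiag_of_mem_completeEdges {B : Finset V} : ∀ e ∈ completeEdges B, ¬ e.IsDiag := by
  intro e
  induction e with
  | _ v w => exact fun h => (mem_completeEdges.1 h).2.2

theorem disjoint_completeEdges {B C : Finset V} (h : Disjoint B C) :
    Disjoint (completeEdges B) (completeEdges C) := by
  rw [Finset.disjoint_left]
  intro e
  induction e with
  | _ v w =>
    exact fun h₁ h₂ => Finset.disjoint_left.1 h (mem_completeEdges.1 h₁).1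
      (mem_completeEdges.1 h₂).1

theorem completeEdges_subset_edgeSet {G : SimpleGraph V} {B : Finset V} :
    (completeEdges B : Set (Sym2 V)) ⊆ G.edgeSet ↔ G.IsClique B := by
  constructor
  · intro h v hv w hw hvw
    exact h (Finset.mem_coe.2 (mem_completeEdges.2 ⟨hv, hw, hvw⟩))
  · intro h e
    induction e with
    | _ v w =>
      intro he
      obtain ⟨hv, hw, hvw⟩ := mem_completeEdges.1 (Finset.mem_coe.1 he)
      exact h hv hw hvw

variable [Finite V]

theorem binomialRandom_real_forall_not_isClique {ι : Type*} (p : I) (T : Finset ι)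
    (B : ι → Finset V) (k : ℕ) (hB : ∀ i ∈ T, (B i).card = k)
    (hd : (T : Set ι).PairwiseDisjoint B) :
    (binomialRandom V p).real {G | ∀ i ∈ T, ¬ G.IsClique (B i : Set V)} =
      (1 - (p : ℝ) ^ k.choose 2) ^ T.card := by
  have h := binomialRandom_real_forall_not_subset p T (fun i => completeEdges (B i))
    (fun i _ => not_isDiag_of_mem_completeEdges)
    (fun i hi j hj hij => disjoint_completeEdges (hd hi hj hij)) ∅ (by simp) (by simp)
  simp only [completeEdges_subset_edgeSet, card_completeEdges, Finset.coe_empty,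
    Set.empty_subset, true_and, Finset.card_empty, pow_zero, one_mul] at h
  rw [h, Finset.prod_congr rfl (g := fun _ => 1 - (p : ℝ) ^ k.choose 2)]
  · simp
  · intro i hi
    rw [hB i hi]

theorem binomialRandom_real_forall_isClique {ι : Type*} (p : I) (T : Finset ι)
    (B : ι → Finset V) (k : ℕ) (hB : ∀ i ∈ T, (B i).card = k)
    (hd : (T : Set ι).PairwiseDisjoint B) :
    (binomialRandom V p).real {G | ∀ i ∈ T, G.IsClique (B i : Set V)} =
      (p : ℝ) ^ (T.card * k.choose 2) := by
  have h := binomialRandom_real_subset_edgeSet p (T.biUnion fun i => completeEdges (B i))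
    (by
      intro e he
      obtain ⟨i, -, he⟩ := Finset.mem_biUnion.1 he
      exact not_isDiag_of_mem_completeEdges e he)
  rw [Finset.card_biUnion fun i hi j hj hij => disjoint_completeEdges (hd hi hj hij),
    Finset.sum_congr rfl (g := fun _ => k.choose 2)
      (fun i hi => by rw [card_completeEdges, hB i hi]), Finset.sum_const, smul_eq_mul] at h
  rw [← h]
  congr 1
  ext G
  simp [← completeEdges_subset_edgeSet]

end CompleteEdges

end SimpleGraph

/-! ### Sparse random graphs have few cliques -/

namespace SimpleGraph

/-- `G` contains `s` pairwise disjoint cliques with `L` vertices each. -/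
def HasDisjointCliques {V : Type*} (G : SimpleGraph V) (L s : ℕ) : Prop :=
  ∃ B : Fin s → Finset V, (∀ i, G.IsNClique L (B i)) ∧ Pairwise (Function.onFun Disjoint B)

open Classical in
/-- A maximal family of disjoint `L`-cliques covers a small set of vertices, outside of
which all cliques have fewer than `L` vertices. -/
theorem card_isClique_le_of_not_hasDisjointCliques {V : Type*} [Fintype V] (G : SimpleGraph V)
    {L s : ℕ} (hL : 0 < L) (h : ¬ G.HasDisjointCliques L s) :
    (Finset.univ.filter fun K : Finset V => G.IsClique K).card ≤
      2 ^ (s * L) * (Fintype.card V + 1) ^ L := by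
  obtain ⟨𝓕, h𝓕, hmax⟩ := Finset.exists_max_image
    (Finset.univ.filter fun 𝓕 : Finset (Finset V) =>
      (∀ B ∈ 𝓕, G.IsNClique L B) ∧ (𝓕 : Set (Finset V)).PairwiseDisjoint id) Finset.card
    ⟨∅, by simp⟩
  simp only [Finset.mem_filter, Finset.mem_univ, true_and] at h𝓕 hmax
  have hcard : 𝓕.card ≤ s := by
    by_contra! hlt
    obtain ⟨𝓖, h𝓖, rfl⟩ := Finset.exists_subset_card_eq hlt.le
    refine h ⟨fun i => 𝓖.equivFin.symm i, fun i => h𝓕.1 _ (h𝓖 (𝓖.equivFin.symm i).2), ?_⟩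
    intro i j hij
    exact h𝓕.2 (h𝓖 (𝓖.equivFin.symm i).2) (h𝓖 (𝓖.equivFin.symm j).2)
      fun heq => hij (𝓖.equivFin.symm.injective (Subtype.ext heq))
  set T := 𝓕.biUnion id with hT
  have hTcard : T.card ≤ s * L := by
    refine (Finset.card_biUnion_le_card_mul _ _ L fun B hB => (h𝓕.1 B hB).card_eq.le).trans ?_
    exact Nat.mul_le_mul_right L hcard
  have hout : ∀ K : Finset V, G.IsClique K → (K \ T).card ≤ L := by
    intro K hK
    by_contra! hlt
    obtain ⟨B, hBK, hB⟩ := Finset.exists_subset_card_eq hlt.le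
    have hdis : ∀ C ∈ 𝓕, Disjoint B C := fun C hC =>
      (Finset.disjoint_of_subset_left hBK Finset.sdiff_disjoint).mono_right
        (Finset.subset_biUnion_of_mem id hC)
    have hB𝓕 : B ∉ 𝓕 := by
      intro hmem
      have := Finset.disjoint_self_iff_empty B |>.1 (hdis B hmem)
      rw [this, Finset.card_empty] at hB
      omega
    have := hmax (insert B 𝓕) ⟨?_, ?_⟩
    · rw [Finset.card_insert_of_notMem hB𝓕] at this
      omega
    · intro C hC
      rcases Finset.mem_insert.1 hC with rfl | hC
      · exact ⟨hK.subset (Finset.coe_subset.2 (hBK.trans Finset.sdiff_subset)), hB⟩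
      · exact h𝓕.1 C hC
    · rw [Finset.coe_insert]
      exact h𝓕.2.insert fun C hC _ => hdis C hC
  calc (Finset.univ.filter fun K : Finset V => G.IsClique K).card
      ≤ (T.powerset ×ˢ ((Finset.univ : Finset V).powerset.filter fun K => K.card ≤ L)).card := by
        refine Finset.card_le_card_of_injOn (fun K => (K ∩ T, K \ T)) ?_ ?_
        · intro K hK
          simp only [Finset.coe_filter, Finset.mem_univ, true_and, Set.mem_ofPred_eq] at hK
          simpa using hout K hK
        · intro K _ K' _ heq
          rw [Prod.mk.injEq] at heq
          rw [← Finset.sdiff_union_inter K T, ← Finset.sdiff_union_inter K' T, heq.1, heq.2]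
    _ ≤ 2 ^ (s * L) * (Fintype.card V + 1) ^ L := by
        rw [Finset.card_product, Finset.card_powerset]
        exact Nat.mul_le_mul (Nat.pow_le_pow_right (by norm_num) hTcard)
          (CliqueSearch.card_filter_card_le _ L)

theorem binomialRandom_real_hasDisjointCliques_le (n : ℕ) (p : I) (L s : ℕ) :
    (binomialRandom (Fin n) p).real {G | G.HasDisjointCliques L s} ≤
      (n : ℝ) ^ (L * s) * (p : ℝ) ^ (s * L.choose 2) := by
  classical
  set 𝓑 := (Fintype.piFinset fun _ : Fin s => (Finset.univ : Finset (Fin n)).powersetCard L).filter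
    fun B => Pairwise (Function.onFun Disjoint B)
  have hsub : {G : SimpleGraph (Fin n) | G.HasDisjointCliques L s} ⊆
      ⋃ B ∈ 𝓑, {G | ∀ i ∈ (Finset.univ : Finset (Fin s)), G.IsClique (B i : Set (Fin n))} := by
    rintro G ⟨B, hB, hd⟩
    simp only [Set.mem_iUnion]
    refine ⟨B, ?_, fun i _ => (hB i).isClique⟩
    simp only [𝓑, Finset.mem_filter, Fintype.mem_piFinset, Finset.mem_powersetCard]
    exact ⟨fun i => ⟨Finset.subset_univ _, (hB i).card_eq⟩, hd⟩
  have hcard : 𝓑.card ≤ n ^ (L * s) := by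
    refine (Finset.card_filter_le _ _).trans ?_
    rw [Fintype.card_piFinset_const, Finset.card_powersetCard, Finset.card_univ, Fintype.card_fin,
      pow_mul]
    exact Nat.pow_le_pow_left (Nat.choose_le_pow n L) s
  calc (binomialRandom (Fin n) p).real {G | G.HasDisjointCliques L s}
      ≤ ∑ B ∈ 𝓑, (binomialRandom (Fin n) p).real
          {G | ∀ i ∈ (Finset.univ : Finset (Fin s)), G.IsClique (B i : Set (Fin n))} :=
        (measureReal_mono hsub (measure_ne_top _ _)).trans
          (measureReal_biUnion_finset_le _ _)
    _ = ∑ B ∈ 𝓑, (p : ℝ) ^ (s * L.choose 2) := by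
        refine Finset.sum_congr rfl fun B hB => ?_
        simp only [𝓑, Finset.mem_filter, Fintype.mem_piFinset, Finset.mem_powersetCard] at hB
        rw [binomialRandom_real_forall_isClique p Finset.univ B L (fun i _ => (hB.1 i).2)
          fun i _ j _ hij => hB.2 hij, Finset.card_univ, Fintype.card_fin]
    _ ≤ (n : ℝ) ^ (L * s) * (p : ℝ) ^ (s * L.choose 2) := by
        rw [Finset.sum_const, nsmul_eq_mul]
        have : (0 : ℝ) ≤ p := p.2.1
        gcongr
        exact_mod_cast hcard

end SimpleGraph

namespace CliqueSearch

open Classical in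
theorem card_cliques_toNat_le {n : ℕ} (G : SimpleGraph (Fin n)) (k : ℕ) :
    (cliques (toNat G) n k).card ≤
      (Finset.univ.filter fun K : Finset (Fin n) => G.IsClique K).card := by
  rw [← Finset.card_map ⟨Finset.map Fin.valEmbedding, Finset.map_injective _⟩]
  refine Finset.card_le_card fun Q hQ => ?_
  simp only [cliques, Finset.mem_filter, Finset.mem_powerset] at hQ
  obtain ⟨S, rfl, hS⟩ := exists_map_eq_of_isClique hQ.1 hQ.2.1
  exact Finset.mem_map.2 ⟨S, by simpa using hS, rfl⟩

/-- The running time on the random graphs `G(n, p(n))` is above `f(k) · (n + 1) ^ d` only with a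
probability that decreases faster than the inverse of any polynomial. -/
def HasSmallTail (p : ℕ → I) : Prop :=
  ∃ (f : ℕ → ℕ) (d : ℕ), ∀ k s : ℕ, ∀ᶠ n : ℕ in atTop,
    (SimpleGraph.binomialRandom (Fin n) (p n)).real
      {G | f k * (n + 1) ^ d < Clique.time program G k} ≤ 1 / (n : ℝ) ^ s

theorem time_le_of_not_hasDisjointCliques {n L s : ℕ} {G : SimpleGraph (Fin n)} (hL : 0 < L)
    (hn : 2 ^ (s * L) ≤ n) (hG : ¬ G.HasDisjointCliques L s) (k : ℕ) :
    Clique.time program G k ≤ 400 * (n + 1) ^ (L + 3) := by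
  have h₁ : (cliques (toNat G) n k).card ≤ 2 ^ (s * L) * (n + 1) ^ L := by
    have h := G.card_isClique_le_of_not_hasDisjointCliques hL hG
    rw [Fintype.card_fin] at h
    refine (card_cliques_toNat_le G k).trans (le_of_eq_of_le ?_ h)
    congr!
  calc Clique.time program G k
      ≤ 400 * (n + 1) ^ 2 * (cliques (toNat G) n k).card :=
        time_program_le G k n le_rfl (.inl rfl)
    _ ≤ 400 * (n + 1) ^ 2 * ((n + 1) * (n + 1) ^ L) := by
        refine Nat.mul_le_mul_left _ (h₁.trans ?_)
        exact Nat.mul_le_mul_right _ (hn.trans (Nat.le_succ n))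
    _ = 400 * (n + 1) ^ (L + 3) := by ring

theorem hasSmallTail_of_le_rpow {p : ℕ → I} {δ : ℝ} (hδ : 0 < δ)
    (hp : ∀ᶠ n : ℕ in atTop, (p n : ℝ) ≤ (n : ℝ) ^ (-δ)) : HasSmallTail p := by
  -- For this `L`, the expected number of `L`-cliques is at most `n ^ L * n ^ (-2 * L)`.
  obtain ⟨L, hL⟩ := exists_nat_gt (4 / δ + 1)
  have hL₁ : 1 < (L : ℝ) := lt_of_le_of_lt (by have : 0 < 4 / δ := by positivity
                                               linarith) hL
  have hL₀ : 0 < L := by exact_mod_cast (zero_lt_one.trans hL₁)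
  have hδL : (L : ℝ) + 1 ≤ δ * (L.choose 2 : ℝ) := by
    have h₁ : 4 ≤ δ * (L - 1) := by
      have : 4 / δ < L - 1 := by linarith
      rw [div_lt_iff₀ hδ] at this
      linarith
    rw [Nat.cast_choose_two]
    nlinarith
  refine ⟨fun _ => 400, L + 3, fun k s => ?_⟩
  filter_upwards [hp, eventually_ge_atTop (2 ^ (s * L)), eventually_ge_atTop 1] with n hpn hn hn₁
  have hn₀ : (0 : ℝ) < n := by exact_mod_cast hn₁
  have hsub : {G : SimpleGraph (Fin n) | 400 * (n + 1) ^ (L + 3) < Clique.time program G k} ⊆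
      {G | G.HasDisjointCliques L s} := by
    intro G hG
    by_contra hno
    have hG' : 400 * (n + 1) ^ (L + 3) < Clique.time program G k := hG
    exact absurd hG' (not_lt.2 (time_le_of_not_hasDisjointCliques hL₀ hn hno k))
  calc (SimpleGraph.binomialRandom (Fin n) (p n)).real
        {G | 400 * (n + 1) ^ (L + 3) < Clique.time program G k}
      ≤ (n : ℝ) ^ (L * s) * (p n : ℝ) ^ (s * L.choose 2) :=
        (measureReal_mono hsub).trans
          (SimpleGraph.binomialRandom_real_hasDisjointCliques_le n (p n) L s)
    _ ≤ (n : ℝ) ^ (L * s) * ((n : ℝ) ^ (-δ)) ^ (s * L.choose 2) := by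
        have : (0 : ℝ) ≤ p n := (p n).2.1
        gcongr
    _ = (n : ℝ) ^ ((L : ℝ) * s + -δ * (s * L.choose 2)) := by
        rw [Real.rpow_add hn₀, ← Nat.cast_mul L, ← Nat.cast_mul s, Real.rpow_mul hn₀.le,
          Real.rpow_natCast, Real.rpow_natCast]
    _ ≤ (n : ℝ) ^ (-(s : ℝ)) := by
        apply Real.rpow_le_rpow_of_exponent_le (by exact_mod_cast hn₁)
        nlinarith [Nat.cast_nonneg (α := ℝ) s]
    _ = 1 / (n : ℝ) ^ s := by
        rw [Real.rpow_neg hn₀.le, Real.rpow_natCast, one_div]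

end CliqueSearch

/-! ### Dense random graphs have cliques on few vertices -/

namespace CliqueSearch

/-- The set of vertices `i k, …, i k + k - 1`. -/
def interval (n k i : ℕ) : Finset (Fin n) := Finset.univ.filter fun v => (v : ℕ) / k = i

theorem map_interval {n k i : ℕ} (hk : 0 < k) (hi : (i + 1) * k ≤ n) :
    (interval n k i).map Fin.valEmbedding = Finset.Ico (i * k) ((i + 1) * k) := by
  ext v
  simp only [interval, Finset.mem_map, Finset.mem_filter, Finset.mem_univ, true_and,
    Finset.mem_Ico, Fin.valEmbedding_apply]
  have hdiv : v / k = i ↔ i * k ≤ v ∧ v < (i + 1) * k := by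
    rw [Nat.div_eq_iff hk, Nat.add_mul, Nat.one_mul]
    omega
  constructor
  · rintro ⟨w, hw, rfl⟩
    exact hdiv.1 hw
  · exact fun h => ⟨⟨v, by omega⟩, hdiv.2 h, rfl⟩

theorem card_interval {n k i : ℕ} (hk : 0 < k) (hi : (i + 1) * k ≤ n) :
    (interval n k i).card = k := by
  rw [← Finset.card_map Fin.valEmbedding, map_interval hk hi, Nat.card_Ico, Nat.add_mul]
  omega

theorem disjoint_interval {n k i j : ℕ} (h : i ≠ j) :
    Disjoint (interval n k i) (interval n k j) := by
  rw [Finset.disjoint_left]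
  intro v hi hj
  simp only [interval, Finset.mem_filter, Finset.mem_univ, true_and] at hi hj
  exact h (hi.symm.trans hj)

theorem time_le_of_isClique_interval {n k i t : ℕ} {G : SimpleGraph (Fin n)} (hk : 0 < k)
    (hi : i < t) (ht : t * k ≤ n) (h : G.IsClique (interval n k i : Set (Fin n))) :
    Clique.time program G k ≤ 400 * (n + 1) ^ 2 * (t * k + 1) ^ k := by
  have hit : (i + 1) * k ≤ t * k := Nat.mul_le_mul_right k hi
  refine (time_program_le G k (t * k) ht (.inr ⟨(interval n k i).map Fin.valEmbedding, ?_, ?_⟩)).trans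
    (Nat.mul_le_mul_left _ (card_cliques_le _ _ _))
  · rw [map_interval hk (hit.trans ht)]
    intro v hv
    simp only [Finset.mem_Ico, Finset.mem_range] at hv ⊢
    omega
  · exact SimpleGraph.IsNClique.map ⟨h, card_interval hk (hit.trans ht)⟩

/-- Eventually, one of `⌊n ^ (1 / (2 * k))⌋` disjoint `k`-sets is a clique with overwhelming
probability. -/
theorem eventually_pow_floor_le (k s : ℕ) (hk : 0 < k) {p : ℕ → I}
    (hp : ∀ ε > 0, ∀ᶠ n : ℕ in atTop, (n : ℝ) ^ (-ε : ℝ) ≤ p n) :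
    ∀ᶠ n : ℕ in atTop,
      (1 - (p n : ℝ) ^ k.choose 2) ^ ⌊(n : ℝ) ^ (1 / (2 * k) : ℝ)⌋₊ ≤ 1 / (n : ℝ) ^ s := by
  have hk' : (0 : ℝ) < k := by exact_mod_cast hk
  set C := k.choose 2
  set β : ℝ := 1 / (4 * k) with hβ
  have hβ₀ : 0 < β := by positivity
  have h2β : 1 / (2 * k) = β + β := by rw [hβ]; field_simp; norm_num
  have hlog : ∀ᶠ n : ℕ in atTop, 2 * s * Real.log n ≤ (n : ℝ) ^ β := by
    have := ((isLittleO_log_rpow_atTop hβ₀).const_mul_left (2 * s)).bound one_pos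
    filter_upwards [tendsto_natCast_atTop_atTop.eventually this] with n hn
    rw [one_mul, Real.norm_of_nonneg (Real.rpow_nonneg (Nat.cast_nonneg n) β)] at hn
    exact (le_abs_self _).trans hn
  filter_upwards [hp (β / (C + 1)) (by positivity), hlog, eventually_ge_atTop 1] with n hpn hlogn hn
  have hn₁ : (1 : ℝ) ≤ n := by exact_mod_cast hn
  have hn₀ : (0 : ℝ) < n := by linarith
  set t := ⌊(n : ℝ) ^ (1 / (2 * k) : ℝ)⌋₊ with ht
  -- The number of sets is at least `n ^ (2 * β) / 2`, and each is a clique with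
  -- probability at least `n ^ (-β)`.
  have ht₁ : (n : ℝ) ^ (β + β) ≤ 2 * t := by
    have h₁ : 1 ≤ (n : ℝ) ^ (β + β) := Real.one_le_rpow hn₁ (by positivity)
    have h₂ : (n : ℝ) ^ (β + β) < t + 1 := by
      rw [ht, h2β]
      exact Nat.lt_floor_add_one _
    have h₃ : (1 : ℝ) ≤ t := by
      rw [ht, h2β]
      exact_mod_cast (Nat.le_floor (by exact_mod_cast h₁) : 1 ≤ ⌊(n : ℝ) ^ (β + β)⌋₊)
    linarith
  have hpC : (n : ℝ) ^ (-β) ≤ (p n : ℝ) ^ C := by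
    calc (n : ℝ) ^ (-β) ≤ (n : ℝ) ^ (-(β / (C + 1)) * C) := by
          apply Real.rpow_le_rpow_of_exponent_le hn₁
          rw [neg_mul, neg_le_neg_iff, div_mul_eq_mul_div, div_le_iff₀ (by positivity)]
          nlinarith
      _ = ((n : ℝ) ^ (-(β / (C + 1)))) ^ C := by rw [Real.rpow_mul hn₀.le, Real.rpow_natCast]
      _ ≤ (p n : ℝ) ^ C := by gcongr
  have hst : s * Real.log n ≤ t * (p n : ℝ) ^ C := by
    have h₁ : (n : ℝ) ^ β = (n : ℝ) ^ (β + β) * (n : ℝ) ^ (-β) := by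
      rw [← Real.rpow_add hn₀]
      ring_nf
    have h₂ : (n : ℝ) ^ (β + β) * (n : ℝ) ^ (-β) ≤ 2 * t * (p n : ℝ) ^ C := by gcongr
    linarith
  have hp₁ : (p n : ℝ) ^ C ≤ 1 := pow_le_one₀ (p n).2.1 (p n).2.2
  calc (1 - (p n : ℝ) ^ C) ^ t ≤ Real.exp (-(p n : ℝ) ^ C) ^ t := by
        have := Real.one_sub_le_exp_neg ((p n : ℝ) ^ C)
        have : 0 ≤ 1 - (p n : ℝ) ^ C := by linarith
        gcongr
    _ = Real.exp (-(t * (p n : ℝ) ^ C)) := by rw [← Real.exp_nat_mul]; ring_nf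
    _ ≤ Real.exp (-(s * Real.log n)) := Real.exp_le_exp.2 (neg_le_neg hst)
    _ = 1 / (n : ℝ) ^ s := by
        rw [Real.exp_neg, ← Real.log_pow, Real.exp_log (by positivity), one_div]

theorem hasSmallTail_of_rpow_le {p : ℕ → I}
    (hp : ∀ ε > 0, ∀ᶠ n : ℕ in atTop, (n : ℝ) ^ (-ε : ℝ) ≤ p n) : HasSmallTail p := by
  refine ⟨fun k => 400 * (k + 1) ^ k, 3, fun k s => ?_⟩
  rcases Nat.eq_zero_or_pos k with rfl | hk
  · refine Eventually.of_forall fun n => ?_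
    have hempty : {G : SimpleGraph (Fin n) | 400 * (0 + 1) ^ 0 * (n + 1) ^ 3 <
        Clique.time program G 0} = ∅ := by
      rw [Set.eq_empty_iff_forall_notMem]
      intro G
      have h := time_program_le G 0 n le_rfl (.inl rfl)
      have h' := card_cliques_le (toNat G) n 0
      intro hG
      have hG' : 400 * (0 + 1) ^ 0 * (n + 1) ^ 3 < Clique.time program G 0 := hG
      refine absurd hG' (not_lt.2 (h.trans ?_))
      rw [pow_zero, mul_one, mul_assoc]
      refine Nat.mul_le_mul_left 400 ?_
      rw [pow_succ (n + 1) 2]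
      exact Nat.mul_le_mul_left _ (h'.trans (by simp))
    rw [hempty, measureReal_empty]
    positivity
  filter_upwards [eventually_pow_floor_le k s hk hp, eventually_ge_atTop (k ^ 2),
    eventually_ge_atTop 1] with n hprob hkn hn
  have hk' : (0 : ℝ) < k := by exact_mod_cast hk
  have hk₁ : (1 : ℝ) ≤ k := by exact_mod_cast hk
  have hn₁ : (1 : ℝ) ≤ n := by exact_mod_cast hn
  have hn₀ : (0 : ℝ) < n := by linarith
  set t := ⌊(n : ℝ) ^ (1 / (2 * k) : ℝ)⌋₊ with ht
  have htle : (t : ℝ) ≤ (n : ℝ) ^ (1 / (2 * k) : ℝ) := Nat.floor_le (by positivity)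
  have ht₁ : 1 ≤ t := by
    apply Nat.le_floor
    exact_mod_cast Real.one_le_rpow hn₁ (by positivity)
  have htk : t * k ≤ n := by
    have h₁ : (n : ℝ) ^ (1 / (2 * k) : ℝ) ≤ √n := by
      rw [Real.sqrt_eq_rpow]
      apply Real.rpow_le_rpow_of_exponent_le hn₁
      apply one_div_le_one_div_of_le <;> linarith
    have h₂ : (k : ℝ) ≤ √n := Real.le_sqrt_of_sq_le (by exact_mod_cast hkn)
    have : (t : ℝ) * k ≤ n := by
      calc (t : ℝ) * k ≤ √n * √n := by gcongr; exact htle.trans h₁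
        _ = n := Real.mul_self_sqrt hn₀.le
    exact_mod_cast this
  have htn : t ^ k ≤ n := by
    have : (t : ℝ) ^ k ≤ n := by
      calc (t : ℝ) ^ k ≤ ((n : ℝ) ^ (1 / (2 * k) : ℝ)) ^ k := by gcongr
        _ = (n : ℝ) ^ (1 / 2 : ℝ) := by
            rw [← Real.rpow_natCast, ← Real.rpow_mul hn₀.le]
            congr 1
            field_simp
        _ ≤ (n : ℝ) ^ (1 : ℝ) := Real.rpow_le_rpow_of_exponent_le hn₁ (by norm_num)
        _ = n := Real.rpow_one _
    exact_mod_cast this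
  have hsub : {G : SimpleGraph (Fin n) | 400 * (k + 1) ^ k * (n + 1) ^ 3 <
      Clique.time program G k} ⊆
      {G | ∀ i ∈ Finset.range t, ¬ G.IsClique (interval n k i : Set (Fin n))} := by
    intro G hG i hi hclique
    have hG' : 400 * (k + 1) ^ k * (n + 1) ^ 3 < Clique.time program G k := hG
    refine absurd hG' (not_lt.2 ?_)
    calc Clique.time program G k ≤ 400 * (n + 1) ^ 2 * (t * k + 1) ^ k :=
          time_le_of_isClique_interval hk (Finset.mem_range.1 hi) htk hclique
      _ ≤ 400 * (n + 1) ^ 2 * (t * (k + 1)) ^ k := by gcongr; linarith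
      _ = 400 * (k + 1) ^ k * (n + 1) ^ 2 * t ^ k := by rw [mul_pow]; ring
      _ ≤ 400 * (k + 1) ^ k * (n + 1) ^ 2 * (n + 1) := by gcongr; omega
      _ = 400 * (k + 1) ^ k * (n + 1) ^ 3 := by ring
  refine (measureReal_mono hsub (measure_ne_top _ _)).trans ?_
  rw [SimpleGraph.binomialRandom_real_forall_not_isClique (p n) (Finset.range t) (interval n k) k
    (fun i hi => card_interval hk ((Nat.mul_le_mul_right k (Finset.mem_range.1 hi)).trans htk))
    fun i _ j _ hij => disjoint_interval hij, Finset.card_range]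
  exact hprob

end CliqueSearch

/-! ### From small tails to the two notions of efficiency on average -/

namespace CliqueSearch

theorem HasSmallTail.runsInTypFPT {p : ℕ → I} (h : HasSmallTail p) :
    Clique.RunsInTypFPT program p := by
  obtain ⟨f, d, h⟩ := h
  refine ⟨f, (Polynomial.X + 1) ^ d, fun k q hq => ?_⟩
  have hdeg : q.degree < (Polynomial.X ^ (q.natDegree + 1) : Polynomial ℝ).degree := by
    rw [Polynomial.degree_X_pow]
    exact Polynomial.degree_le_natDegree.trans_lt (by exact_mod_cast Nat.lt_succ_self _)
  have hlim := (Polynomial.div_tendsto_atTop_zero_of_degree_lt q _ hdeg).comp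
    (tendsto_natCast_atTop_atTop (R := ℝ))
  have hlt := hlim.eventually (gt_mem_nhds one_pos)
  obtain ⟨n₀, hn₀⟩ := eventually_atTop.1
    ((h k (q.natDegree + 1)).and (hq.and (hlt.and (eventually_ge_atTop 1))))
  refine ⟨n₀, fun n hn => ?_⟩
  obtain ⟨htail, hpos, hlt, hn₁⟩ := hn₀ n hn.le
  have hn' : (0 : ℝ) < n := by exact_mod_cast hn₁
  simp only [Function.comp_apply, Polynomial.eval_pow, Polynomial.eval_X] at hlt
  rw [div_lt_one (by positivity)] at hlt
  simp only [Polynomial.eval_pow, Polynomial.eval_add, Polynomial.eval_X, Polynomial.eval_one]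
  exact htail.trans_lt (one_div_lt_one_div_of_lt hpos hlt)

theorem time_program_le_pow {n : ℕ} (G : SimpleGraph (Fin n)) (k : ℕ) :
    Clique.time program G k ≤ 400 * (n + 1) ^ (k + 2) := by
  refine (time_program_le G k n le_rfl (.inl rfl)).trans ?_
  rw [pow_add, Nat.mul_comm (_ ^ k), ← Nat.mul_assoc]
  exact Nat.mul_le_mul_left _ (card_cliques_le _ n k)

/-- A tail bound for a random variable that never exceeds `b` bounds its expectation. -/
theorem lintegral_le_of_le_of_le {Ω : Type*} [MeasurableSpace Ω] (μ : Measure Ω)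
    [IsProbabilityMeasure μ] (X : Ω → ℝ≥0∞) {a b : ℝ} (hb : 0 ≤ b) (ha : 0 ≤ a)
    (hX : ∀ ω, X ω ≤ ENNReal.ofReal b) :
    ∫⁻ ω, X ω ∂μ ≤ ENNReal.ofReal (a + b * μ.real {ω | ENNReal.ofReal a < X ω}) := by
  set E := {ω | ENNReal.ofReal a < X ω}
  calc ∫⁻ ω, X ω ∂μ
      ≤ ∫⁻ ω, ENNReal.ofReal a + E.indicator (fun _ => ENNReal.ofReal b) ω ∂μ := by
        refine lintegral_mono fun ω => ?_
        by_cases hω : ω ∈ E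
        · rw [Set.indicator_of_mem hω]
          exact (hX ω).trans le_add_self
        · rw [Set.indicator_of_notMem hω, add_zero]
          exact not_lt.1 hω
    _ ≤ ENNReal.ofReal a + ENNReal.ofReal b * μ E := by
        rw [lintegral_add_left measurable_const, lintegral_const, measure_univ, mul_one]
        gcongr
        exact lintegral_indicator_const_le E _
    _ = ENNReal.ofReal (a + b * μ.real E) := by
        rw [ENNReal.ofReal_add ha (by positivity), ENNReal.ofReal_mul hb, ofReal_measureReal]

theorem HasSmallTail.runsInAvgFPT {p : ℕ → I} (h : HasSmallTail p) :
    Clique.RunsInAvgFPT program p := by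
  obtain ⟨f, d, h⟩ := h
  suffices hsum : ∀ k : ℕ, ∑' n : ℕ+, ∫⁻ G, (Clique.time program G k : ℝ≥0∞) /
      ((n : ℕ) : ℝ≥0∞) ^ (d + 2) ∂(SimpleGraph.binomialRandom (Fin n) (p n)) ≠ ⊤ by
    choose F hF using fun k => ENNReal.exists_nat_gt (hsum k)
    exact ⟨d + 2, F, hF⟩
  intro k
  obtain ⟨n₀, hn₀⟩ := eventually_atTop.1 (h k (k + 2))
  -- The first term bounds the expectation for large `n`, the second one for the finitely many
  -- remaining values of `n`.
  set M : ℝ := (f k * 2 ^ d + 400 * 2 ^ (k + 2)) + 400 * (n₀ + 1) ^ (k + 4) with hM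
  have hterm : ∀ n : ℕ, 0 < n → ∫⁻ G, (Clique.time program G k : ℝ≥0∞) /
      (n : ℝ≥0∞) ^ (d + 2) ∂(SimpleGraph.binomialRandom (Fin n) (p n)) ≤
      ENNReal.ofReal (M * (1 / (n : ℝ) ^ 2)) := by
    intro n hn
    have hn' : (0 : ℝ) < n := by exact_mod_cast hn
    have hn₁ : (1 : ℝ) ≤ n := by exact_mod_cast hn
    have hcast : ∀ x : ℕ, (x : ℝ≥0∞) / (n : ℝ≥0∞) ^ (d + 2) =
        ENNReal.ofReal (x / (n : ℝ) ^ (d + 2)) := by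
      intro x
      rw [ENNReal.ofReal_div_of_pos (by positivity), ENNReal.ofReal_pow hn'.le,
        ENNReal.ofReal_natCast, ENNReal.ofReal_natCast]
    simp only [hcast]
    have hbound : ∀ G : SimpleGraph (Fin n),
        ENNReal.ofReal ((Clique.time program G k : ℝ) / (n : ℝ) ^ (d + 2)) ≤
          ENNReal.ofReal (400 * (n + 1) ^ (k + 2) / (n : ℝ) ^ (d + 2)) := by
      intro G
      apply ENNReal.ofReal_le_ofReal
      gcongr
      exact_mod_cast time_program_le_pow G k
    rcases le_or_gt n n₀ with hle | hlt
    · refine (lintegral_mono hbound).trans ?_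
      rw [lintegral_const, measure_univ, mul_one]
      apply ENNReal.ofReal_le_ofReal
      have hnn₀ : (n : ℝ) ≤ n₀ := by exact_mod_cast hle
      rw [mul_one_div]
      refine div_le_div₀ (by positivity) ?_ (by positivity)
        (pow_le_pow_right₀ hn₁ (Nat.le_add_left 2 d))
      have h₁ : ((n : ℝ) + 1) ^ (k + 2) ≤ (n₀ + 1) ^ (k + 4) := by
        calc ((n : ℝ) + 1) ^ (k + 2) ≤ (n₀ + 1) ^ (k + 2) := by gcongr
          _ ≤ (n₀ + 1) ^ (k + 4) := pow_le_pow_right₀ (by linarith) (by omega)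
      have h₂ : (0 : ℝ) ≤ f k * 2 ^ d + 400 * 2 ^ (k + 2) := by positivity
      linarith
    · have htail := hn₀ n hlt.le
      refine (lintegral_le_of_le_of_le _ _ (a := f k * (n + 1) ^ d / (n : ℝ) ^ (d + 2))
        (by positivity) (by positivity) hbound).trans (ENNReal.ofReal_le_ofReal ?_)
      have hset : {G : SimpleGraph (Fin n) |
          ENNReal.ofReal (f k * (n + 1) ^ d / (n : ℝ) ^ (d + 2)) <
            ENNReal.ofReal ((Clique.time program G k : ℝ) / (n : ℝ) ^ (d + 2))} ⊆
          {G | f k * (n + 1) ^ d < Clique.time program G k} := by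
        intro G hG
        have h₁ := (ENNReal.ofReal_lt_ofReal_iff'.1 hG).1
        have h₂ := (div_lt_div_iff_of_pos_right (by positivity)).1 h₁
        exact_mod_cast h₂
      have hn2 : (n : ℝ) + 1 ≤ 2 * n := by linarith
      calc f k * (n + 1) ^ d / (n : ℝ) ^ (d + 2) + 400 * (n + 1) ^ (k + 2) / (n : ℝ) ^ (d + 2) *
            (SimpleGraph.binomialRandom (Fin n) (p n)).real {G : SimpleGraph (Fin n) |
              ENNReal.ofReal (f k * (n + 1) ^ d / (n : ℝ) ^ (d + 2)) <
              ENNReal.ofReal ((Clique.time program G k : ℝ) / (n : ℝ) ^ (d + 2))}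
          ≤ f k * (2 * n) ^ d / (n : ℝ) ^ (d + 2) +
            400 * (2 * n) ^ (k + 2) / (n : ℝ) ^ 2 * (1 / (n : ℝ) ^ (k + 2)) := by
            gcongr
            · omega
            · exact (measureReal_mono hset (measure_ne_top _ _)).trans htail
        _ = (f k * 2 ^ d + 400 * 2 ^ (k + 2)) * (1 / (n : ℝ) ^ 2) := by
            rw [mul_pow, mul_pow]
            field_simp
            ring
        _ ≤ M * (1 / (n : ℝ) ^ 2) := by
            gcongr
            rw [hM]
            have : (0 : ℝ) ≤ 400 * (n₀ + 1) ^ (k + 4) := by positivity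
            linarith
  have hsummable : Summable fun n : ℕ+ => M * (1 / ((n : ℕ) : ℝ) ^ 2) :=
    ((Real.summable_one_div_nat_pow.2 one_lt_two).mul_left M).comp_injective
      (i := fun n : ℕ+ => (n : ℕ)) PNat.coe_injective
  exact ne_top_of_le_ne_top hsummable.tsum_ofReal_ne_top (ENNReal.tsum_le_tsum fun n => hterm n n.pos)

theorem hasSmallTail_of_hasLimitExponent_zero {p : ℕ → I} (h : HasLimitExponent p 0) :
    HasSmallTail p := by
  obtain ⟨g, -, hp, hg⟩ := h
  refine hasSmallTail_of_rpow_le fun ε hε => ?_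
  filter_upwards [hg.eventually (gt_mem_nhds hε), eventually_ge_atTop 2] with n hgn hn
  rw [hp n hn]
  have : (1 : ℝ) ≤ n := by exact_mod_cast (show 1 ≤ n by omega)
  exact Real.rpow_le_rpow_of_exponent_le this (by linarith)

theorem hasSmallTail_of_not_hasLimitExponent_zero {p : ℕ → I} (hp : IsNatural p)
    (h : ¬ HasLimitExponent p 0) : HasSmallTail p := by
  rcases hp with hp | ⟨c, g, hg₀, hp, hg⟩
  · refine hasSmallTail_of_le_rpow one_pos (Eventually.of_forall fun n => ?_)
    rw [hp n]
    exact Real.rpow_nonneg (Nat.cast_nonneg n) _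
  · have hc : 0 < c := by
      refine lt_of_le_of_ne (ge_of_tendsto' hg hg₀) ?_
      rintro rfl
      exact h ⟨g, hg₀, hp, hg⟩
    refine hasSmallTail_of_le_rpow (half_pos hc) ?_
    filter_upwards [hg.eventually (lt_mem_nhds (half_lt_self hc)), eventually_ge_atTop 2]
      with n hgn hn
    rw [hp n hn]
    have : (1 : ℝ) ≤ n := by exact_mod_cast (show 1 ≤ n by omega)
    exact Real.rpow_le_rpow_of_exponent_le this (by linarith)

end CliqueSearch

theorem theorem2 :
    ∃ A B : RAM.Program, Clique.Decides A ∧ Clique.Decides B ∧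
      ∀ p : ℕ → unitInterval, IsNatural p →
        (HasLimitExponent p 0 → Clique.RunsInTypFPT A p ∧ Clique.RunsInAvgFPT A p) ∧
        (¬ HasLimitExponent p 0 → Clique.RunsInTypFPT B p ∧ Clique.RunsInAvgFPT B p) := by
  refine ⟨CliqueSearch.program, CliqueSearch.program, CliqueSearch.decides_program,
    CliqueSearch.decides_program, fun p hp => ⟨fun h => ?_, fun h => ?_⟩⟩
  · have ht := CliqueSearch.hasSmallTail_of_hasLimitExponent_zero h
    exact ⟨ht.runsInTypFPT, ht.runsInAvgFPT⟩
  · have ht := CliqueSearch.hasSmallTail_of_not_hasLimitExponent_zero hp h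
    exact ⟨ht.runsInTypFPT, ht.runsInAvgFPT⟩
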